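/- Let $M$ be a connected complex manifold of complex dimension $n$ with complex structure $J$, let $T$ be a real torus acting smoothly on $M$ by biholomorphisms, and let $X$ be a real holomorphic vector field on $M$ such that $JX$ lies in the Lie algebra of $T$. Let $D$ be a compact connected complex manifold with a Kähler form $\omega_D$ whose Ricci form satisfies $\rho_{\omega_D}=\omega_D$. Let $\omega$ be (the Kähler form of) a complete $T$-invariant Kähler metric on $M$ for which there are compact sets $K\subset M$ and $\widehat K\subset\mathbb{C}\times D$ with $\{0\}\times D\subset\widehat K$, a biholomorphism $\nu:M\setminus K\to(\mathbb{C}\times D)\setminus\widehat K$ and a number $\lambda>0$ such that, with $z$ the coordinate on $\mathbb{C}$, 1. $d\nu(X)=\frac{2}{\lambda}\operatorname{Re}(z\partial_z)$; 2. $\omega=\nu^*\left(\frac{i}{2}\partial\bar\partial|z|^{2\lambda}+\omega_D\right)$ on $M\setminus K$; 3. $\rho_\omega+\frac12\mathcal{L}_X\omega-\omega=i\partial\bar\partial F_1$ for some compactly supported $F_1\in C^\infty(M)$ with $\mathcal{L}_{JX}F_1=0$. Then there exists $\tilde\varphi\in C^\infty(M)$ with $\mathcal{L}_{JX}\tilde\varphi=0$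 and $\omega_{\tilde\varphi}:=\omega+i\partial\bar\partial\tilde\varphi>0$ such that $$\rho_{\omega_{\tilde\varphi}}+\tfrac12\mathcal{L}_X\omega_{\tilde\varphi}=\omega_{\tilde\varphi}$$ if and only if for all $a\in\mathbb{R}$ there exist $\varphi\in C^\infty(M)$ with $\mathcal{L}_{JX}\varphi=0$ and $\omega+i\partial\bar\partial\varphi>0$, and a compactly supported $F_2\in C^\infty(M)$ with $\mathcal{L}_{JX}F_2=0$ and $$\rho_\omega+\tfrac12\mathcal{L}_X\omega-\omega=i\partial\bar\partial F_2,$$ such that $$\log\left(\frac{(\omega+i\partial\bar\partial\varphi)^n}{\omega^n}\right)-\frac{X}{2}\cdot\varphi+\varphi=F_2+a.$$ Here $\rho$ denotes the Ricci form, and all functions are real-valued. -/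

import Mathlib

open scoped Manifold ContDiff Topology

noncomputable section

namespace KRSoliton

/-! Complex manifolds are charted spaces over a finite-dimensional complex vector space `E` with
analytic complex transition maps. The underlying real manifold has the same charts and the model
`𝓘(ℝ, E)`. As everywhere in Mathlib, the tangent space at `p` is `E`, read in the preferred chart
`chartAt E p`; since the charts are holomorphic, the complex structure `J` on it is multiplication
by `Complex.I`. -/

section Flat

variable (E : Type*) [NormedAddCommGroup E] [NormedSpace ℂ E]

/-- Multiplication by `i`, as a real linear map. -/
def mulI : E →L[ℝ] E :=
  (Complex.I • ContinuousLinearMap.id ℂ E).restrictScalars ℝ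

/-- The real frame `b₁, i b₁, b₂, i b₂, …` belonging to a complex basis `b` of `E`: the coordinate
vector fields `∂/∂x₁, ∂/∂y₁, ∂/∂x₂, ∂/∂y₂, …` of the linear coordinates `zⱼ = xⱼ + i yⱼ` dual
to `b`. -/
def frame [FiniteDimensional ℂ E] : Fin (Module.finrank ℂ E) × Fin 2 → E :=
  fun j => if j.2 = 0 then Module.finBasis ℂ E j.1 else Complex.I • Module.finBasis ℂ E j.1

variable {E}

/-- `i∂∂̄f` on an open subset of `E`. With `B` the real Hessian of `f`, this is the real 2-form
`(u, v) ↦ (B(iu, v) - B(u, iv)) / 2`, which in linear coordinates is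
`i ∑ ∂²f/∂zⱼ∂z̄ₖ dzⱼ ∧ dz̄ₖ`. -/
def ddbarFlat (f : E → ℝ) (x : E) : E →L[ℝ] E →L[ℝ] ℝ :=
  (1 / 2 : ℝ) •
    ((fderiv ℝ (fderiv ℝ f) x).bilinearComp (mulI E) (ContinuousLinearMap.id ℝ E) -
      (fderiv ℝ (fderiv ℝ f) x).bilinearComp (ContinuousLinearMap.id ℝ E) (mulI E))

/-- The Lie derivative of a 2-form `W` along a vector field `V` on an open subset of `E`:
`(L_V W)(u, v) = (V · W)(u, v) + W(DV u, v) + W(u, DV v)`. -/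
def lieFlat (V : E → E) (W : E → E →L[ℝ] E →L[ℝ] ℝ) (x : E) : E →L[ℝ] E →L[ℝ] ℝ :=
  fderiv ℝ W x (V x) +
    (W x).bilinearComp (fderiv ℝ V x) (ContinuousLinearMap.id ℝ E) +
    (W x).bilinearComp (ContinuousLinearMap.id ℝ E) (fderiv ℝ V x)

/-- The `k`-fold wedge power `α ∧ … ∧ α` of a 2-form, evaluated on `2k` vectors. -/
def wedgePow (α : E →L[ℝ] E →L[ℝ] ℝ) (k : ℕ) (v : Fin k × Fin 2 → E) : ℝ :=
  (1 / 2 : ℝ) ^ k * ∑ σ : Equiv.Perm (Fin k × Fin 2),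
    ((Equiv.Perm.sign σ : ℤ) : ℝ) * ∏ i : Fin k, α (v (σ (i, 0))) (v (σ (i, 1)))

/-- The coefficient of the top power `αⁿ` with respect to `dx₁ ∧ dy₁ ∧ … ∧ dxₙ ∧ dyₙ`. -/
def topCoeff [FiniteDimensional ℂ E] (α : E →L[ℝ] E →L[ℝ] ℝ) : ℝ :=
  wedgePow α (Module.finrank ℂ E) (frame E)

end Flat

section Manifold

variable (E : Type*) [NormedAddCommGroup E] [NormedSpace ℂ E]
  (M : Type*) [TopologicalSpace M]

/-- Real vector fields on `M`; the value at `p` lies in `T_pM = E`. -/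
abbrev VectorField := M → E

/-- Fields of real bilinear forms on the tangent spaces `T_pM = E`. -/
abbrev TwoForm := M → E →L[ℝ] E →L[ℝ] ℝ

variable {E M} [ChartedSpace E M]

/-- The vector field `JX`. -/
def rotate (X : VectorField E M) : VectorField E M := fun p => Complex.I • X p

/-- The derivative `X · f = L_X f` of a function along a vector field. -/
def dirDeriv (X : VectorField E M) (f : M → ℝ) (p : M) : ℝ :=
  mfderiv 𝓘(ℝ, E) 𝓘(ℝ, ℝ) f p (X p)

/-- Smooth real-valued functions on `M`. -/
def IsSmooth (E : Type*) [NormedAddCommGroup E] [NormedSpace ℂ E] {M : Type*} [TopologicalSpace M]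
    [ChartedSpace E M] (f : M → ℝ) : Prop :=
  ContMDiff 𝓘(ℝ, E) 𝓘(ℝ, ℝ) ∞ f

/-- The expression of a vector field in a chart. -/
def chartField (e : OpenPartialHomeomorph M E) (X : VectorField E M) (x : E) : E :=
  mfderiv 𝓘(ℝ, E) 𝓘(ℝ, E) e (e.symm x) (X (e.symm x))

/-- The expression of a 2-form in a chart, that is, its pullback by the inverse of the chart. -/
def chartForm (e : OpenPartialHomeomorph M E) (Ω : TwoForm E M) (x : E) : E →L[ℝ] E →L[ℝ] ℝ :=
  (Ω (e.symm x)).bilinearComp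
    (mfderiv 𝓘(ℝ, E) 𝓘(ℝ, E) e.symm x : E →L[ℝ] E)
    (mfderiv 𝓘(ℝ, E) 𝓘(ℝ, E) e.symm x : E →L[ℝ] E)

/-- Real holomorphic vector fields: smooth, and holomorphic in holomorphic coordinates
(equivalently `L_X J = 0`). -/
structure IsRealHolomorphic (X : VectorField E M) : Prop where
  smooth : ∀ e ∈ atlas E M, ContDiffOn ℝ ∞ (chartField e X) e.target
  holomorphic : ∀ e ∈ atlas E M, DifferentiableOn ℂ (chartField e X) e.target

/-- `i∂∂̄f` on `M`. -/
def ddbar (f : M → ℝ) : TwoForm E M := fun p =>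
  ddbarFlat (f ∘ (chartAt E p).symm) (chartAt E p p)

/-- The Lie derivative `L_X Ω` of a 2-form. -/
def lieDeriv (X : VectorField E M) (Ω : TwoForm E M) : TwoForm E M := fun p =>
  lieFlat (chartField (chartAt E p) X) (chartForm (chartAt E p) Ω) (chartAt E p p)

/-- The Ricci form of a Kähler form `Ω`: in holomorphic coordinates
`ρ = -i∂∂̄ log det (g_{jk̄})`, and `det (g_{jk̄})` is, up to a constant factor, the coefficient
of `Ωⁿ`. -/
def ricciForm [FiniteDimensional ℂ E] (Ω : TwoForm E M) : TwoForm E M := fun p =>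
  -ddbarFlat (fun x => Real.log (topCoeff (chartForm (chartAt E p) Ω x))) (chartAt E p p)

/-- The function `Ω'ⁿ / Ωⁿ`, `n = dim_ℂ M`. -/
def volumeRatio [FiniteDimensional ℂ E] (Ω' Ω : TwoForm E M) (p : M) : ℝ :=
  topCoeff (Ω' p) / topCoeff (Ω p)

/-- `Ω > 0`: positivity of `Ω(u, Ju)`. -/
def IsPositive (Ω : TwoForm E M) : Prop :=
  ∀ p : M, ∀ u : E, u ≠ 0 → 0 < Ω p u (Complex.I • u)

/-- Kähler forms: smooth closed positive real (1,1)-forms. -/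
structure IsKahlerForm (Ω : TwoForm E M) : Prop where
  smooth : ∀ e ∈ atlas E M, ContDiffOn ℝ ∞ (chartForm e Ω) e.target
  alternating : ∀ (p : M) (u : E), Ω p u u = 0
  typeOneOne : ∀ (p : M) (u v : E), Ω p (Complex.I • u) (Complex.I • v) = Ω p u v
  closed : ∀ e ∈ atlas E M, ∀ x ∈ e.target, ∀ u v w : E,
    fderiv ℝ (chartForm e Ω) x u v w + fderiv ℝ (chartForm e Ω) x v w u +
      fderiv ℝ (chartForm e Ω) x w u v = 0
  positive : IsPositive Ω

/-- The Riemannian distance of the metric `g(u, v) = Ω(u, Jv)`. -/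
def kahlerEDist (Ω : TwoForm E M) (p q : M) : ENNReal :=
  letI : ∀ x : M, ENorm (TangentSpace 𝓘(ℝ, E) x) := fun x =>
    ⟨fun u : E => ENNReal.ofReal (Real.sqrt (Ω x u (Complex.I • u)))⟩
  Manifold.riemannianEDist 𝓘(ℝ, E) p q

/-- Completeness of the metric of `Ω`: Cauchy sequences converge. -/
def IsCompleteMetric (Ω : TwoForm E M) : Prop :=
  ∀ s : ℕ → M,
    (∀ ε : ENNReal, 0 < ε → ∃ N, ∀ i ≥ N, ∀ j ≥ N, kahlerEDist Ω (s i) (s j) < ε) →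
      ∃ p, Filter.Tendsto s Filter.atTop (𝓝 p)

/-- The exponential map of the real torus `(S¹)ᵏ`, whose Lie algebra is `ℝᵏ`. -/
def torusExp {k : ℕ} (b : Fin k → ℝ) : Fin k → Circle := fun j => Circle.exp (b j)

/-- A smooth action of the real torus `(S¹)ᵏ` on `M` by biholomorphisms. Smoothness in the torus
variable is expressed on the universal cover `ℝᵏ`. -/
structure IsHolomorphicTorusAction (E : Type*) [NormedAddCommGroup E] [NormedSpace ℂ E]
    (M : Type*) [TopologicalSpace M] [ChartedSpace E M] (k : ℕ)
    [MulAction (Fin k → Circle) M] : Prop where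
  smooth : ContMDiff (𝓘(ℝ, Fin k → ℝ).prod 𝓘(ℝ, E)) 𝓘(ℝ, E) ∞
    (fun q : (Fin k → ℝ) × M => torusExp q.1 • q.2)
  holomorphic : ∀ t : Fin k → Circle, ContMDiff 𝓘(ℂ, E) 𝓘(ℂ, E) ω (fun p : M => t • p)

/-- The vector field `Y` belongs to the Lie algebra of the torus: it is the velocity field of a
one-parameter subgroup `s ↦ exp(s b)`. -/
def InTorusLieAlgebra (k : ℕ) [MulAction (Fin k → Circle) M] (Y : VectorField E M) : Prop :=
  ∃ b : Fin k → ℝ, ∀ p : M,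
    Y p = (mfderiv 𝓘(ℝ, ℝ) 𝓘(ℝ, E) (fun s : ℝ => torusExp (s • b) • p) 0 : ℝ →L[ℝ] E) 1

/-- Invariance of a 2-form under the torus action: `t^*Ω = Ω` for all `t`. -/
def IsTorusInvariant (k : ℕ) [MulAction (Fin k → Circle) M] (Ω : TwoForm E M) : Prop :=
  ∀ (t : Fin k → Circle) (p : M) (u v : E),
    Ω (t • p) ((mfderiv 𝓘(ℝ, E) 𝓘(ℝ, E) (fun q : M => t • q) p : E →L[ℝ] E) u)
      ((mfderiv 𝓘(ℝ, E) 𝓘(ℝ, E) (fun q : M => t • q) p : E →L[ℝ] E) v) = Ω p u v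

/-- The form `(i/2) ∂∂̄|z|^{2λ}` on `ℂ ∖ {0}`. -/
def coneForm (lam : ℝ) (z : ℂ) : ℂ →L[ℝ] ℂ →L[ℝ] ℝ :=
  (1 / 2 : ℝ) • ddbarFlat (fun w : ℂ => ‖w‖ ^ (2 * lam)) z

/-- `Ω` is a background metric on `M` for the vector field `X`: a complete torus-invariant Kähler
metric which, through a biholomorphism `ν` from the complement of a compact set `K ⊆ M` to the
complement of a compact set `Khat ⊆ ℂ × D`, is the product of the metric `(i/2)∂∂̄|z|^{2λ}` and of
`ΩD`, with `dν(X) = (2/λ) Re(z∂_z)`, and such that `ρ_Ω + ½ L_X Ω - Ω = i∂∂̄F₁` for a compactly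
supported `JX`-invariant smooth function `F₁`. -/
structure IsBackgroundMetric [FiniteDimensional ℂ E]
    {F : Type*} [NormedAddCommGroup F] [NormedSpace ℂ F]
    {D : Type*} [TopologicalSpace D] [ChartedSpace F D]
    (k : ℕ) [MulAction (Fin k → Circle) M]
    (X : VectorField E M) (Ω : TwoForm E M) (ΩD : TwoForm F D)
    (lam : ℝ) (K : Set M) (Khat : Set (ℂ × D))
    (ν : OpenPartialHomeomorph M (ℂ × D)) : Prop where
  kahler : IsKahlerForm Ω
  complete : IsCompleteMetric Ω
  torusInvariant : IsTorusInvariant k Ω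
  isCompact_K : IsCompact K
  isCompact_Khat : IsCompact Khat
  zeroFibre_subset : ∀ x : D, ((0 : ℂ), x) ∈ Khat
  source_eq : ν.source = Kᶜ
  target_eq : ν.target = Khatᶜ
  holomorphic : ContMDiffOn 𝓘(ℂ, E) (𝓘(ℂ, ℂ).prod 𝓘(ℂ, F)) ω ν ν.source
  holomorphic_symm : ContMDiffOn (𝓘(ℂ, ℂ).prod 𝓘(ℂ, F)) 𝓘(ℂ, E) ω ν.symm ν.target
  lam_pos : 0 < lam
  /-- The `ℂ`-component of `dν(X)`; the real vector field `Re(z∂_z)` has the value `z/2` at `z`. -/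
  map_field_fst : ∀ p ∈ ν.source,
    (mfderiv 𝓘(ℝ, E) 𝓘(ℝ, ℂ) (fun q => (ν q).1) p : E →L[ℝ] ℂ) (X p) =
      (2 / lam : ℝ) • ((ν p).1 / 2)
  /-- The `D`-component of `dν(X)`. -/
  map_field_snd : ∀ p ∈ ν.source,
    (mfderiv 𝓘(ℝ, E) 𝓘(ℝ, F) (fun q => (ν q).2) p : E →L[ℝ] F) (X p) = 0
  /-- `Ω` is the pullback by `ν` of the product form. -/
  pullback_eq : ∀ p ∈ ν.source, ∀ u v : E,
    Ω p u v =
      coneForm lam (ν p).1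
        ((mfderiv 𝓘(ℝ, E) 𝓘(ℝ, ℂ) (fun q => (ν q).1) p : E →L[ℝ] ℂ) u)
        ((mfderiv 𝓘(ℝ, E) 𝓘(ℝ, ℂ) (fun q => (ν q).1) p : E →L[ℝ] ℂ) v) +
      ΩD (ν p).2
        ((mfderiv 𝓘(ℝ, E) 𝓘(ℝ, F) (fun q => (ν q).2) p : E →L[ℝ] F) u)
        ((mfderiv 𝓘(ℝ, E) 𝓘(ℝ, F) (fun q => (ν q).2) p : E →L[ℝ] F) v)
  ricci_potential : ∃ F₁ : M → ℝ, IsSmooth E F₁ ∧ HasCompactSupport F₁ ∧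
    (∀ p, dirDeriv (rotate X) F₁ p = 0) ∧
    ricciForm Ω + (1 / 2 : ℝ) • lieDeriv X Ω - Ω = ddbar F₁

end Manifold

end KRSoliton

end

/-! Write `S(Ω) = ρ_Ω + ½ L_X Ω - Ω` and `MA(f) = log((Ω + i∂∂̄f)ⁿ / Ωⁿ) - ½ X·f + f`. Ricci forms
differ by `i∂∂̄` of the log volume ratio (`ricciForm_eq_sub`), and `L_X` commutes with `i∂∂̄`
because `X` is holomorphic (`lieDeriv_add_ddbar`). Hence `i∂∂̄ MA(f) = S(Ω) - S(Ω + i∂∂̄f)`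
(`ddbar_mongeAmpere`). If `S(Ω) = i∂∂̄g`, then `Ω + i∂∂̄f` is a soliton exactly when `MA(f) - g` is
pluriharmonic. This gives the implication from the Monge-Ampère equation to the soliton equation,
for any single `a`.

Conversely, let `φ'` solve the soliton equation and put `G = MA(φ') - F₁`. It is pluriharmonic and
also `JX`-invariant, since `JX` generates torus elements preserving `Ω` and `φ'`
(`dirDeriv_rotate_mongeAmpere`). Locally `G` is the real part of a holomorphic function, and `JX·G =
0` makes the derivative of that function along `X` real, hence constant; on connected `M`, `X·G = c`
(`exists_dirDeriv_eq_const`). Replacing `φ'` by `φ' - G + const` leaves the metric unchanged and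
turns `MA` into `F₁ + c/2 + const`, so the constant can be tuned to reach any `a`. There is no need
to show that `G` itself is constant. -/

namespace KRSoliton

/-! ### `i∂∂̄`, holomorphic maps and holomorphic fields on open subsets of `E`. -/

section FlatCalculus

variable {E : Type*} [NormedAddCommGroup E] [NormedSpace ℂ E]
  {F : Type*} [NormedAddCommGroup F] [NormedSpace ℂ F]
  {G : Type*} [NormedAddCommGroup G] [NormedSpace ℝ G]

@[simp] lemma mulI_apply (u : E) : mulI E u = Complex.I • u := rfl

lemma ddbarFlat_apply (f : E → ℝ) (x u v : E) :
    ddbarFlat f x u v = (1 / 2 : ℝ) * (fderiv ℝ (fderiv ℝ f) x (Complex.I • u) v -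
      fderiv ℝ (fderiv ℝ f) x u (Complex.I • v)) := by
  simp [ddbarFlat]

lemma lieFlat_apply (V : E → E) (W : E → E →L[ℝ] E →L[ℝ] ℝ) (x u v : E) :
    lieFlat V W x u v = fderiv ℝ W x (V x) u v + W x (fderiv ℝ V x u) v +
      W x u (fderiv ℝ V x v) := by
  simp [lieFlat]

lemma ddbarFlat_self (f : E → ℝ) {x : E} (hf : IsSymmSndFDerivAt ℝ f x) (u : E) :
    ddbarFlat f x u u = 0 := by
  rw [ddbarFlat_apply, hf.eq (Complex.I • u) u, sub_self, mul_zero]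

lemma I_smul_I_smul (u : E) : Complex.I • Complex.I • u = -u := by
  rw [smul_smul, Complex.I_mul_I, neg_one_smul]

lemma ddbarFlat_I_I (f : E → ℝ) (x u v : E) :
    ddbarFlat f x (Complex.I • u) (Complex.I • v) = ddbarFlat f x u v := by
  simp only [ddbarFlat_apply, I_smul_I_smul, map_neg, neg_apply]
  ring

lemma ddbarFlat_congr {f g : E → ℝ} {x : E} (h : f =ᶠ[𝓝 x] g) :
    ddbarFlat f x = ddbarFlat g x := by
  simp only [ddbarFlat, h.fderiv.fderiv_eq]

section Smooth

variable {H : Type*} [NormedAddCommGroup H] [NormedSpace ℝ H]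
  {U : Set H} {f : H → G}

lemma contDiffOn_fderiv (hU : IsOpen U) (hf : ContDiffOn ℝ ∞ f U) :
    ContDiffOn ℝ ∞ (fderiv ℝ f) U :=
  hf.fderiv_of_isOpen hU (by simp)

lemma differentiableAt_of_contDiffOn (hU : IsOpen U) (hf : ContDiffOn ℝ ∞ f U) {x : H}
    (hx : x ∈ U) : DifferentiableAt ℝ f x :=
  (hf.contDiffAt (hU.mem_nhds hx)).differentiableAt (by simp)

lemma isSymmSndFDerivAt_of_contDiffOn (hU : IsOpen U) (hf : ContDiffOn ℝ ∞ f U) {x : H}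
    (hx : x ∈ U) : IsSymmSndFDerivAt ℝ f x :=
  (hf.contDiffAt (hU.mem_nhds hx)).isSymmSndFDerivAt (by
    simpa using WithTop.coe_le_coe.2 (le_top (a := (2 : ℕ∞))))

/-- Freezing the second vector lets identities between first derivatives be differentiated once
more. -/
lemma fderiv_fderiv_apply (hU : IsOpen U) (hf : ContDiffOn ℝ ∞ f U) {x : H}
    (hx : x ∈ U) (u v : H) :
    fderiv ℝ (fderiv ℝ f) x u v = fderiv ℝ (fun y => fderiv ℝ f y v) x u := by
  rw [fderiv_clm_apply (differentiableAt_of_contDiffOn hU (contDiffOn_fderiv hU hf) hx)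
    (differentiableAt_const v)]
  simp

end Smooth

lemma ddbarFlat_add {U : Set E} (hU : IsOpen U) {f g : E → ℝ} (hf : ContDiffOn ℝ ∞ f U)
    (hg : ContDiffOn ℝ ∞ g U) {x : E} (hx : x ∈ U) :
    ddbarFlat (f + g) x = ddbarFlat f x + ddbarFlat g x := by
  have h : fderiv ℝ (f + g) =ᶠ[𝓝 x] fderiv ℝ f + fderiv ℝ g := by
    filter_upwards [hU.mem_nhds hx] with y hy
    exact fderiv_add (differentiableAt_of_contDiffOn hU hf hy)
      (differentiableAt_of_contDiffOn hU hg hy)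
  ext u v
  simp only [ddbarFlat_apply, add_apply]
  rw [h.fderiv_eq, fderiv_add
    (differentiableAt_of_contDiffOn hU (contDiffOn_fderiv hU hf) hx)
    (differentiableAt_of_contDiffOn hU (contDiffOn_fderiv hU hg) hx)]
  simp only [add_apply]
  ring

lemma ddbarFlat_const_smul (c : ℝ) {U : Set E} (hU : IsOpen U) {f : E → ℝ}
    (hf : ContDiffOn ℝ ∞ f U) {x : E} (hx : x ∈ U) :
    ddbarFlat (c • f) x = c • ddbarFlat f x := by
  have h : fderiv ℝ (c • f) =ᶠ[𝓝 x] c • fderiv ℝ f := by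
    filter_upwards [hU.mem_nhds hx] with y hy
    exact fderiv_const_smul (differentiableAt_of_contDiffOn hU hf hy) c
  ext u v
  simp only [ddbarFlat_apply, smul_apply]
  rw [h.fderiv_eq, fderiv_const_smul
    (differentiableAt_of_contDiffOn hU (contDiffOn_fderiv hU hf) hx) c]
  simp only [smul_apply, smul_eq_mul]
  ring

lemma hasFDerivAt_apply_apply {W : E → E →L[ℝ] E →L[ℝ] ℝ} {x : E} (hW : DifferentiableAt ℝ W x)
    (u v : E) : HasFDerivAt (fun y => W y u v) (((fderiv ℝ W x).flip u).flip v) x := by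
  have := (hW.hasFDerivAt.clm_apply (hasFDerivAt_const u x)).clm_apply (hasFDerivAt_const v x)
  simpa only [ContinuousLinearMap.comp_zero, zero_add] using this

lemma contDiffOn_bilinearComp {H : Type*} [NormedAddCommGroup H] [NormedSpace ℝ H] {U : Set H}
    {W : H → E →L[ℝ] E →L[ℝ] ℝ} {A B : H → E →L[ℝ] E} (hW : ContDiffOn ℝ ∞ W U)
    (hA : ContDiffOn ℝ ∞ A U) (hB : ContDiffOn ℝ ∞ B U) :
    ContDiffOn ℝ ∞ (fun x => (W x).bilinearComp (A x) (B x)) U := by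
  have e : (fun x => (W x).bilinearComp (A x) (B x)) = fun x =>
      ((ContinuousLinearMap.compL ℝ E E ℝ).flip (B x)).comp ((W x).comp (A x)) := by
    ext; simp
  rw [e]
  exact (contDiffOn_const.clm_apply hB).clm_comp (hW.clm_comp hA)

/-- Along a holomorphic map the real second derivative is complex bilinear. -/
lemma fderiv_fderiv_I_smul {U : Set E} (hU : IsOpen U) {g : E → F}
    (hg : ContDiffOn ℝ ∞ g U) (hgc : DifferentiableOn ℂ g U) {x : E} (hx : x ∈ U) (u v : E) :
    fderiv ℝ (fderiv ℝ g) x u (Complex.I • v) =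
      Complex.I • fderiv ℝ (fderiv ℝ g) x u v := by
  have h : (fun y => fderiv ℝ g y (Complex.I • v)) =ᶠ[𝓝 x]
      fun y => Complex.I • fderiv ℝ g y v := by
    filter_upwards [hU.mem_nhds hx] with y hy
    rw [(hgc.differentiableAt (hU.mem_nhds hy)).fderiv_restrictScalars ℝ]
    simp
  rw [fderiv_fderiv_apply hU hg hx, fderiv_fderiv_apply hU hg hx, h.fderiv_eq]
  rw [fderiv_fun_const_smul]
  · rfl
  · exact (differentiableAt_of_contDiffOn hU (contDiffOn_fderiv hU hg) hx).clm_apply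
      (differentiableAt_const v)

lemma fderiv_I_smul {U : Set E} (hU : IsOpen U) {g : E → F} (hgc : DifferentiableOn ℂ g U)
    {x : E} (hx : x ∈ U) (v : E) :
    fderiv ℝ g x (Complex.I • v) = Complex.I • fderiv ℝ g x v := by
  rw [(hgc.differentiableAt (hU.mem_nhds hx)).fderiv_restrictScalars ℝ]
  simp

/-- `i∂∂̄` commutes with pullback by holomorphic maps. -/
lemma ddbarFlat_comp {U : Set E} (hU : IsOpen U) {V : Set F} (hV : IsOpen V) {g : E → F}
    (hg : ContDiffOn ℝ ∞ g U) (hgc : DifferentiableOn ℂ g U) (hgV : Set.MapsTo g U V)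
    {f : F → ℝ} (hf : ContDiffOn ℝ ∞ f V) {x : E} (hx : x ∈ U) (u v : E) :
    ddbarFlat (f ∘ g) x u v = ddbarFlat f (g x) (fderiv ℝ g x u) (fderiv ℝ g x v) := by
  have hfg : ContDiffOn ℝ ∞ (f ∘ g) U := hf.comp hg hgV
  -- Second-order chain rule; its last term is the obstruction to naturality of the Hessian.
  have key : ∀ u v, fderiv ℝ (fderiv ℝ (f ∘ g)) x u v =
      fderiv ℝ (fderiv ℝ f) (g x) (fderiv ℝ g x u) (fderiv ℝ g x v) +
        fderiv ℝ f (g x) (fderiv ℝ (fderiv ℝ g) x u v) := by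
    intro u v
    rw [fderiv_fderiv_apply hU hfg hx]
    have h : (fun y => fderiv ℝ (f ∘ g) y v) =ᶠ[𝓝 x]
        fun y => (fderiv ℝ f ∘ g) y (fderiv ℝ g y v) := by
      filter_upwards [hU.mem_nhds hx] with y hy
      rw [fderiv_comp y (differentiableAt_of_contDiffOn hV hf (hgV hy))
        (differentiableAt_of_contDiffOn hU hg hy)]
      rfl
    have h1 : DifferentiableAt ℝ (fderiv ℝ f) (g x) :=
      differentiableAt_of_contDiffOn hV (contDiffOn_fderiv hV hf) (hgV hx)
    have h2 := differentiableAt_of_contDiffOn hU hg hx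
    have h3 : DifferentiableAt ℝ (fun y => fderiv ℝ g y v) x :=
      (differentiableAt_of_contDiffOn hU (contDiffOn_fderiv hU hg) hx).clm_apply
        (differentiableAt_const v)
    rw [h.fderiv_eq, fderiv_clm_apply (h1.comp x h2) h3, fderiv_comp x h1 h2]
    simp only [add_apply, ContinuousLinearMap.coe_comp, Function.comp_apply,
      ContinuousLinearMap.flip_apply, ← fderiv_fderiv_apply hU hg hx]
    ring
  have hs := isSymmSndFDerivAt_of_contDiffOn hU hg hx
  -- The obstruction terms at `(iu, v)` and `(u, iv)` both equal `Df(i D²g(u, v))`, so they cancel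
  -- in the difference.
  rw [ddbarFlat_apply, ddbarFlat_apply, key, key, fderiv_fderiv_I_smul hU hg hgc hx,
    hs.eq (Complex.I • u) v, fderiv_fderiv_I_smul hU hg hgc hx, hs.eq v u,
    fderiv_I_smul hU hgc hx, fderiv_I_smul hU hgc hx]
  ring

section VectorField

variable {U : Set E} (hU : IsOpen U) {V : E → E} (hV : ContDiffOn ℝ ∞ V U)
  {f : E → ℝ} (hf : ContDiffOn ℝ ∞ f U)

include hU hV hf

lemma contDiffOn_fderiv_apply : ContDiffOn ℝ ∞ (fun y => fderiv ℝ f y (V y)) U :=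
  (contDiffOn_fderiv hU hf).clm_apply hV

lemma fderiv_fderiv_apply_field {x : E} (hx : x ∈ U) (u : E) :
    fderiv ℝ (fun y => fderiv ℝ f y (V y)) x u =
      fderiv ℝ (fderiv ℝ f) x u (V x) + fderiv ℝ f x (fderiv ℝ V x u) := by
  rw [fderiv_clm_apply (differentiableAt_of_contDiffOn hU (contDiffOn_fderiv hU hf) hx)
    (differentiableAt_of_contDiffOn hU hV hx)]
  simp [add_comm]

lemma fderiv_fderiv_fderiv_apply_field {x : E} (hx : x ∈ U) (w u : E) :
    fderiv ℝ (fderiv ℝ (fun y => fderiv ℝ f y (V y))) x w u =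
      fderiv ℝ (fderiv ℝ (fderiv ℝ f)) x w u (V x) +
        fderiv ℝ (fderiv ℝ f) x u (fderiv ℝ V x w) +
        fderiv ℝ (fderiv ℝ f) x w (fderiv ℝ V x u) +
        fderiv ℝ f x (fderiv ℝ (fderiv ℝ V) x w u) := by
  have hf1 := contDiffOn_fderiv hU hf
  have hV1 := contDiffOn_fderiv hU hV
  have d1 := differentiableAt_of_contDiffOn hU hf1 hx
  have d2 := differentiableAt_of_contDiffOn hU (contDiffOn_fderiv hU hf1) hx
  have dV := differentiableAt_of_contDiffOn hU hV hx
  have dV1 := differentiableAt_of_contDiffOn hU hV1 hx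
  rw [fderiv_fderiv_apply hU (contDiffOn_fderiv_apply hU hV hf) hx]
  have h : (fun y => fderiv ℝ (fun y => fderiv ℝ f y (V y)) y u) =ᶠ[𝓝 x]
      fun y => fderiv ℝ (fderiv ℝ f) y u (V y) + fderiv ℝ f y (fderiv ℝ V y u) := by
    filter_upwards [hU.mem_nhds hx] with y hy
    exact fderiv_fderiv_apply_field hU hV hf hy u
  have d3 : DifferentiableAt ℝ (fun y => fderiv ℝ (fderiv ℝ f) y u) x :=
    d2.clm_apply (differentiableAt_const u)
  have d4 : DifferentiableAt ℝ (fun y => fderiv ℝ V y u) x :=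
    dV1.clm_apply (differentiableAt_const u)
  rw [h.fderiv_eq, fderiv_fun_add (d3.clm_apply dV) (d1.clm_apply d4),
    fderiv_clm_apply d3 dV, fderiv_clm_apply d1 d4]
  simp only [add_apply, ContinuousLinearMap.coe_comp, Function.comp_apply,
      ContinuousLinearMap.flip_apply, ← fderiv_fderiv_apply hU hV hx,
      ← fderiv_fderiv_apply hU hf1 hx]
  ring

omit hV in
lemma contDiffOn_ddbarFlat : ContDiffOn ℝ ∞ (ddbarFlat f) U := by
  have h2 := contDiffOn_fderiv hU (contDiffOn_fderiv hU hf)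
  have h : ∀ B C : E →L[ℝ] E,
      ContDiffOn ℝ ∞ (fun x => (fderiv ℝ (fderiv ℝ f) x).bilinearComp B C) U :=
    fun B C => contDiffOn_bilinearComp h2 contDiffOn_const contDiffOn_const
  exact ((h _ _).sub (h _ _)).const_smul (1 / 2 : ℝ)

omit hV in
lemma fderiv_ddbarFlat {x : E} (hx : x ∈ U) (w u v : E) :
    fderiv ℝ (ddbarFlat f) x w u v =
      (1 / 2 : ℝ) * (fderiv ℝ (fderiv ℝ (fderiv ℝ f)) x w (Complex.I • u) v -
        fderiv ℝ (fderiv ℝ (fderiv ℝ f)) x w u (Complex.I • v)) := by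
  have hf2 := contDiffOn_fderiv hU (contDiffOn_fderiv hU hf)
  have d := differentiableAt_of_contDiffOn hU (contDiffOn_ddbarFlat hU hf) hx
  have d2 := differentiableAt_of_contDiffOn hU hf2 hx
  have e2 := hasFDerivAt_apply_apply d2
  have e1 := hasFDerivAt_apply_apply d u v
  have e3 : HasFDerivAt (fun y => ddbarFlat f y u v) _ x :=
    (((e2 (Complex.I • u) v).sub (e2 u (Complex.I • v))).const_mul (1 / 2)).congr_of_eventuallyEq
      (Filter.Eventually.of_forall fun y => ddbarFlat_apply f y u v)
  have := DFunLike.congr_fun (e1.unique e3) w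
  simpa using this

/-- `L_V (i∂∂̄f) = i∂∂̄(V · f)` for a holomorphic vector field `V`. -/
lemma lieFlat_ddbarFlat (hVc : DifferentiableOn ℂ V U) {x : E} (hx : x ∈ U) :
    lieFlat V (ddbarFlat f) x = ddbarFlat (fun y => fderiv ℝ f y (V y)) x := by
  have hf1 := contDiffOn_fderiv hU hf
  have s2 := isSymmSndFDerivAt_of_contDiffOn hU hf hx
  have sV := isSymmSndFDerivAt_of_contDiffOn hU hV hx
  have s3 := isSymmSndFDerivAt_of_contDiffOn hU hf1 hx
  -- Symmetry in the last two slots comes from differentiating the symmetry of the Hessian.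
  have s3' : ∀ w u v, fderiv ℝ (fderiv ℝ (fderiv ℝ f)) x w u v =
      fderiv ℝ (fderiv ℝ (fderiv ℝ f)) x w v u := by
    intro w u v
    have d2 := differentiableAt_of_contDiffOn hU (contDiffOn_fderiv hU hf1) hx
    have e2 := hasFDerivAt_apply_apply d2
    have h : (fun y => fderiv ℝ (fderiv ℝ f) y u v) =ᶠ[𝓝 x]
        fun y => fderiv ℝ (fderiv ℝ f) y v u := by
      filter_upwards [hU.mem_nhds hx] with y hy
      exact (isSymmSndFDerivAt_of_contDiffOn hU hf hy).eq u v
    simpa using DFunLike.congr_fun ((e2 u v).unique ((e2 v u).congr_of_eventuallyEq h)) w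
  have s3'' : ∀ w u, fderiv ℝ (fderiv ℝ (fderiv ℝ f)) x (V x) w u =
      fderiv ℝ (fderiv ℝ (fderiv ℝ f)) x w u (V x) := by
    intro w u
    rw [s3.eq (V x) w, s3']
  ext u v
  -- The terms in `D²V` cancel by complex bilinearity; those in `DV` match because `DV` commutes
  -- with `i`.
  rw [lieFlat_apply, ddbarFlat_apply, fderiv_ddbarFlat hU hf hx, ddbarFlat_apply, ddbarFlat_apply,
    fderiv_fderiv_fderiv_apply_field hU hV hf hx, fderiv_fderiv_fderiv_apply_field hU hV hf hx,
    s3'', s3'', sV.eq (Complex.I • u) v, fderiv_fderiv_I_smul hU hV hVc hx,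
    fderiv_fderiv_I_smul hU hV hVc hx, sV.eq v u, fderiv_I_smul hU hVc hx, fderiv_I_smul hU hVc hx,
    s2.eq v (Complex.I • fderiv ℝ V x u), s2.eq (Complex.I • v) (fderiv ℝ V x u)]
  ring

omit hf in
lemma fderiv_I_smul_field {x : E} (hx : x ∈ U) (u : E) :
    fderiv ℝ (fun y => Complex.I • V y) x u = Complex.I • fderiv ℝ V x u := by
  rw [fderiv_fun_const_smul (differentiableAt_of_contDiffOn hU hV hx)]
  rfl

/-- The derivative in the direction `u` of the identity `JV · f = 0`; this is how invariance enters
the next two lemmas. -/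
lemma snd_fderiv_I_smul_field (hJ : ∀ y ∈ U, fderiv ℝ f y (Complex.I • V y) = 0)
    {x : E} (hx : x ∈ U) (u : E) :
    fderiv ℝ (fderiv ℝ f) x u (Complex.I • V x) +
      fderiv ℝ f x (Complex.I • fderiv ℝ V x u) = 0 := by
  have hIV : ContDiffOn ℝ ∞ (fun y => Complex.I • V y) U :=
    (ContDiff.contDiffOn (mulI E).contDiff (s := Set.univ)).comp hV (Set.mapsTo_univ _ _)
  have h : (fun y => fderiv ℝ f y (Complex.I • V y)) =ᶠ[𝓝 x] fun _ => 0 := by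
    filter_upwards [hU.mem_nhds hx] with y hy
    exact hJ y hy
  have := fderiv_fderiv_apply_field hU hIV hf hx u
  rw [h.fderiv_eq, fderiv_I_smul_field hU hV hx] at this
  simpa using this.symm

/-- If `f` is invariant under `JV`, then so is `V · f`. -/
lemma fderiv_I_smul_field_fderiv_apply (hVc : DifferentiableOn ℂ V U)
    (hJ : ∀ y ∈ U, fderiv ℝ f y (Complex.I • V y) = 0) {x : E} (hx : x ∈ U) :
    fderiv ℝ (fun y => fderiv ℝ f y (V y)) x (Complex.I • V x) = 0 := by
  -- By symmetry of the Hessian, `JV·(V·f)` becomes `V·(JV·f)`: the fields `V` and `JV` commute.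
  rw [fderiv_fderiv_apply_field hU hV hf hx, fderiv_I_smul hU hVc hx,
    (isSymmSndFDerivAt_of_contDiffOn hU hf hx).eq (Complex.I • V x) (V x)]
  exact snd_fderiv_I_smul_field hU hV hf hJ hx _

/-- If `f` is pluriharmonic and invariant under `JV`, then `V · f` is locally constant. -/
lemma fderiv_fderiv_apply_eq_zero (hVc : DifferentiableOn ℂ V U)
    (hJ : ∀ y ∈ U, fderiv ℝ f y (Complex.I • V y) = 0) {x : E} (hx : x ∈ U)
    (hdd : ddbarFlat f x = 0) :
    fderiv ℝ (fun y => fderiv ℝ f y (V y)) x = 0 := by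
  ext u
  rw [fderiv_fderiv_apply_field hU hV hf hx]
  -- The direction `iu` produces the Hessian term at `(iu, iV)`, which pluriharmonicity identifies
  -- with minus the one at `(u, V)`.
  have h1 := snd_fderiv_I_smul_field hU hV hf hJ hx (Complex.I • u)
  have h2 : ddbarFlat f x u (Complex.I • V x) = 0 := by rw [hdd]; rfl
  rw [ddbarFlat_apply, I_smul_I_smul] at h2
  rw [fderiv_I_smul hU hVc hx, I_smul_I_smul] at h1
  simp only [map_neg, zero_apply] at h1 h2 ⊢
  linarith

end VectorField

end FlatCalculus

/-! ### Top powers of 2-forms: change of frame and nonvanishing. -/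

section TopPower

variable {E : Type*} [NormedAddCommGroup E] [NormedSpace ℂ E]

/-- The real frame `b₁, i b₁, b₂, i b₂, …` of a complex basis `b`. -/
noncomputable def realBasis {n : ℕ} (b : Module.Basis (Fin n) ℂ E) :
    Module.Basis (Fin n × Fin 2) ℝ E :=
  Complex.basisOneI.smulTower' b

lemma realBasis_zero {n : ℕ} (b : Module.Basis (Fin n) ℂ E) (j : Fin n) :
    realBasis b (j, 0) = b j := by
  simp [realBasis, Module.Basis.smulTower'_apply]

lemma realBasis_one {n : ℕ} (b : Module.Basis (Fin n) ℂ E) (j : Fin n) :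
    realBasis b (j, 1) = Complex.I • b j := by
  simp [realBasis, Module.Basis.smulTower'_apply]

lemma frame_eq_realBasis [FiniteDimensional ℂ E] :
    frame E = realBasis (Module.finBasis ℂ E) := by
  ext1 ⟨j, l⟩
  fin_cases l
  · simp [frame, realBasis_zero]
  · simp [frame, realBasis_one]

/-- The multilinear map `v ↦ ∏ α(v_{i,0}, v_{i,1})`. -/
noncomputable def pairProd (α : E →L[ℝ] E →L[ℝ] ℝ) (k : ℕ) :
    MultilinearMap ℝ (fun _ : Fin k × Fin 2 => E) ℝ where
  toFun v := ∏ i : Fin k, α (v (i, 0)) (v (i, 1))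
  map_update_add' v j x y := by
    classical
    obtain ⟨j, l⟩ := j
    simp only [← Finset.mul_prod_erase _ _ (Finset.mem_univ j)]
    have h : ∀ z, ∏ i ∈ Finset.univ.erase j, α (Function.update v (j, l) z (i, 0))
        (Function.update v (j, l) z (i, 1)) =
          ∏ i ∈ Finset.univ.erase j, α (v (i, 0)) (v (i, 1)) := by
      intro z
      refine Finset.prod_congr rfl fun i hi => ?_
      have hi := Finset.ne_of_mem_erase hi
      rw [Function.update_of_ne, Function.update_of_ne] <;> simp [hi]
    fin_cases l <;> simp_all [add_mul]
  map_update_smul' v j c x := by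
    classical
    obtain ⟨j, l⟩ := j
    simp only [← Finset.mul_prod_erase _ _ (Finset.mem_univ j)]
    have h : ∀ z, ∏ i ∈ Finset.univ.erase j, α (Function.update v (j, l) z (i, 0))
        (Function.update v (j, l) z (i, 1)) =
          ∏ i ∈ Finset.univ.erase j, α (v (i, 0)) (v (i, 1)) := by
      intro z
      refine Finset.prod_congr rfl fun i hi => ?_
      have hi := Finset.ne_of_mem_erase hi
      rw [Function.update_of_ne, Function.update_of_ne] <;> simp [hi]
    fin_cases l <;> simp_all [mul_assoc]

/-- In top degree an alternating map is a multiple of the determinant, so this form yields the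
change-of-frame formula. -/
lemma wedgePow_eq_alternatization (α : E →L[ℝ] E →L[ℝ] ℝ) (k : ℕ) (v : Fin k × Fin 2 → E) :
    wedgePow α k v = (1 / 2 : ℝ) ^ k * MultilinearMap.alternatization (pairProd α k) v := by
  rw [wedgePow, MultilinearMap.alternatization_apply]
  congr 1
  refine Finset.sum_congr rfl fun σ _ => ?_
  rw [Units.smul_def, zsmul_eq_mul]
  rfl

lemma wedgePow_bilinearComp (α : E →L[ℝ] E →L[ℝ] ℝ) (A : E →L[ℝ] E) (k : ℕ)
    (v : Fin k × Fin 2 → E) :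
    wedgePow (α.bilinearComp A A) k v = wedgePow α k (fun i => A (v i)) := by
  simp [wedgePow]

/-- The behaviour of the top power under a change of frame. -/
lemma wedgePow_eq_det_mul {n : ℕ} (b : Module.Basis (Fin n × Fin 2) ℝ E)
    (α : E →L[ℝ] E →L[ℝ] ℝ) (v : Fin n × Fin 2 → E) :
    wedgePow α n v = b.det v * wedgePow α n b := by
  rw [wedgePow_eq_alternatization, wedgePow_eq_alternatization,
    AlternatingMap.eq_smul_basis_det b (MultilinearMap.alternatization (pairProd α n))]
  simp only [AlternatingMap.smul_apply, smul_eq_mul, Module.Basis.det_self]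
  ring

variable [FiniteDimensional ℂ E]

/-- The determinant factor depends only on the map, so it cancels in quotients of top powers; volume
ratios are therefore independent of charts and invariant under the torus. -/
lemma topCoeff_bilinearComp (α : E →L[ℝ] E →L[ℝ] ℝ) (A : E →L[ℝ] E) :
    topCoeff (α.bilinearComp A A) = LinearMap.det (A : E →ₗ[ℝ] E) * topCoeff α := by
  unfold topCoeff
  rw [frame_eq_realBasis, wedgePow_bilinearComp,
    wedgePow_eq_det_mul (realBasis (Module.finBasis ℂ E))]
  congr 1
  have := (realBasis (Module.finBasis ℂ E)).det_comp (A : E →ₗ[ℝ] E)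
    (realBasis (Module.finBasis ℂ E))
  rw [Module.Basis.det_self, mul_one] at this
  exact this

omit [FiniteDimensional ℂ E] in
/-- In a frame with `α(bⱼ, bₖ) = α(ibⱼ, ibₖ) = 0` and `α(bⱼ, ibₖ) = δⱼₖ`, every nonzero term of the
top power equals `1`. -/
lemma wedgePow_pos_of_unitary {n : ℕ} (α : E →L[ℝ] E →L[ℝ] ℝ) (v : Fin n × Fin 2 → E)
    (h00 : ∀ i j, α (v (i, 0)) (v (j, 0)) = 0) (h11 : ∀ i j, α (v (i, 1)) (v (j, 1)) = 0)
    (h01 : ∀ i j, α (v (i, 0)) (v (j, 1)) = if i = j then 1 else 0)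
    (h10 : ∀ i j, α (v (i, 1)) (v (j, 0)) = if i = j then -1 else 0) :
    0 < wedgePow α n v := by
  -- A nonzero pairing joins the two vectors of one block. Its value is written as the sign of `swap
  -- 0 a.2`, so that it can later be multiplied against `sign σ`.
  have key : ∀ a b : Fin n × Fin 2, α (v a) (v b) ≠ 0 →
      a.1 = b.1 ∧ b.2 = Equiv.swap 0 1 a.2 ∧
        α (v a) (v b) = ((Equiv.Perm.sign (Equiv.swap 0 a.2) : ℤ) : ℝ) := by
    rintro ⟨i, l⟩ ⟨j, m⟩ h
    fin_cases l <;> fin_cases m <;> simp_all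
  have term : ∀ σ : Equiv.Perm (Fin n × Fin 2),
      0 ≤ ((Equiv.Perm.sign σ : ℤ) : ℝ) * ∏ i : Fin n, α (v (σ (i, 0))) (v (σ (i, 1))) := by
    intro σ
    by_cases hz : ∏ i : Fin n, α (v (σ (i, 0))) (v (σ (i, 1))) = 0
    · rw [hz, mul_zero]
    rw [← ne_eq, Finset.prod_ne_zero_iff] at hz
    have hk := fun i => key _ _ (hz i (Finset.mem_univ i))
    -- If two blocks landed in the same one, `σ (i, 0)` would have to avoid both of its members.
    have hinj : Function.Injective fun i => (σ (i, 0)).1 := by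
      intro i j hij
      by_contra hne
      have hij : (σ (i, 0)).1 = (σ (j, 0)).1 := hij
      have h1 : (σ (i, 0)).2 ≠ (σ (j, 0)).2 := fun h => hne (by
        simpa using σ.injective (Prod.ext hij h))
      have h2 : (σ (i, 0)).2 ≠ (σ (j, 1)).2 := fun h => hne (by
        simpa using σ.injective (Prod.ext (hij.trans (hk j).1) h))
      rw [(hk j).2.1] at h2
      revert h1 h2
      generalize (σ (i, 0)).2 = a
      generalize (σ (j, 0)).2 = b
      revert a b
      decide
    let π : Equiv.Perm (Fin n) := Equiv.ofBijective _ (Finite.injective_iff_bijective.1 hinj)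
    -- A contributing `σ` flips inside some blocks, then permutes blocks by `π`. The block
    -- permutation acts on two copies of `Fin n`, so it is even, and `sign σ` is the product of the
    -- flip signs.
    have hσ : σ = (Equiv.prodCongrLeft fun _ : Fin 2 => π) *
        Equiv.prodCongrRight (fun i => Equiv.swap 0 (σ (i, 0)).2) := by
      ext1 ⟨i, l⟩
      fin_cases l
      · simp [π]
      · refine Prod.ext ?_ ?_
        · simp [π, (hk i).1]
        · simp only [Fin.mk_one, Fin.isValue, Equiv.Perm.coe_mul, Function.comp_apply, (hk i).2.1,
            Equiv.prodCongrRight_apply, Equiv.prodCongrLeft_apply]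
          generalize (σ (i, 0)).2 = a
          revert a
          decide
    have hs : Equiv.Perm.sign σ = ∏ i, Equiv.Perm.sign (Equiv.swap 0 (σ (i, 0)).2) := by
      conv_lhs => rw [hσ]
      rw [map_mul, Equiv.Perm.sign_prodCongrRight, Equiv.Perm.sign_prodCongrLeft]
      simp
    rw [hs, Finset.prod_congr rfl fun i _ => (hk i).2.2]
    push_cast
    rw [← Finset.prod_mul_distrib]
    refine Finset.prod_nonneg fun i _ => mul_self_nonneg _
  -- All terms are nonnegative and the identity permutation contributes `1`.
  refine mul_pos (by positivity) (Finset.sum_pos' (fun σ _ => term σ) ⟨1, Finset.mem_univ _, ?_⟩)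
  simp [h01]

/-- Here `V` is only a vector space, so the norm induced by the core does not clash with the given
norm of `E`. -/
lemma exists_orthonormal_basis_of_core {V : Type*} [AddCommGroup V] [Module ℂ V]
    [FiniteDimensional ℂ V] (c : InnerProductSpace.Core ℂ V) :
    ∃ b : Module.Basis (Fin (Module.finrank ℂ V)) ℂ V,
      ∀ i j, c.inner (b i) (b j) = if i = j then 1 else 0 := by
  let _ : NormedAddCommGroup V := c.toNormedAddCommGroup
  let _ : InnerProductSpace ℂ V := InnerProductSpace.ofCore c.toCore
  refine ⟨(stdOrthonormalBasis ℂ V).toBasis, fun i j => ?_⟩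
  have := orthonormal_iff_ite.1 (stdOrthonormalBasis ℂ V).orthonormal i j
  simpa using this

/-- The top power of a positive `(1,1)`-form does not vanish. -/
lemma topCoeff_ne_zero {α : E →L[ℝ] E →L[ℝ] ℝ} (halt : ∀ u, α u u = 0)
    (hI : ∀ u v, α (Complex.I • u) (Complex.I • v) = α u v)
    (hpos : ∀ u, u ≠ 0 → 0 < α u (Complex.I • u)) : topCoeff α ≠ 0 := by
  have hanti : ∀ u v, α u v = -α v u := by
    intro u v
    have := halt (u + v)
    simp only [map_add, add_apply, halt] at this
    linarith
  have hIl : ∀ u v, α (Complex.I • u) v = -α u (Complex.I • v) := by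
    intro u v
    rw [← hI u (Complex.I • v), I_smul_I_smul, map_neg, neg_neg]
  have hIs : ∀ u v, α v (Complex.I • u) = α u (Complex.I • v) := by
    intro u v
    rw [hanti, hIl, neg_neg]
  have hc : ∀ (r : ℂ) (u : E), r • u = r.re • u + r.im • (Complex.I • u) := by
    intro r u
    conv_lhs => rw [← Complex.re_add_im r]
    rw [add_smul, mul_smul]
    simp
  -- The Hermitian form `α(u, iv) + i α(u, v)`, conjugate-linear in the first slot.
  let c : InnerProductSpace.Core ℂ E :=
    { inner := fun u v => (α u (Complex.I • v) : ℂ) + Complex.I * α u v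
      conj_inner_symm := fun u v => by
        apply Complex.ext
        · simp [hIs u v]
        · simp [hanti u v]
      re_inner_nonneg := fun u => by
        by_cases hu : u = 0
        · simp [hu]
        · simpa using (hpos u hu).le
      add_left := fun u v w => by
        simp only [map_add, add_apply]
        push_cast
        ring
      smul_left := fun u v r => by
        rw [hc r u]
        apply Complex.ext
        · simp [hIl, I_smul_I_smul]
        · simp [hIl]
      definite := fun u hu => by
        by_contra h
        have := congrArg Complex.re hu
        have h' := hpos u h
        simp at this
        exact h'.ne' this }
  obtain ⟨b, hb⟩ := exists_orthonormal_basis_of_core c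
  -- Real and imaginary parts of orthonormality.
  have hb' : ∀ i j, α (b i) (b j) = 0 ∧ α (b i) (Complex.I • b j) = if i = j then 1 else 0 := by
    intro i j
    have h : (α (b i) (Complex.I • b j) : ℂ) + Complex.I * α (b i) (b j) = _ := hb i j
    have h1 := congrArg Complex.re h
    have h2 := congrArg Complex.im h
    simp only [Complex.add_re, Complex.ofReal_re, Complex.mul_re, Complex.I_re, zero_mul,
      Complex.I_im, Complex.ofReal_im, mul_zero, sub_self, add_zero] at h1
    simp only [Complex.add_im, Complex.ofReal_im, Complex.mul_im, Complex.I_re, zero_mul,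
      Complex.I_im, Complex.ofReal_re, one_mul, zero_add] at h2
    rw [h1, h2]
    split_ifs <;> simp
  have hp := wedgePow_pos_of_unitary α (realBasis b)
    (fun i j => by rw [realBasis_zero, realBasis_zero, (hb' i j).1])
    (fun i j => by rw [realBasis_one, realBasis_one, hI, (hb' i j).1])
    (fun i j => by rw [realBasis_zero, realBasis_one, (hb' i j).2])
    (fun i j => by
      rw [realBasis_zero, realBasis_one, hIl, (hb' i j).2]
      split_ifs <;> simp)
  rw [wedgePow_eq_det_mul (realBasis (Module.finBasis ℂ E))] at hp
  unfold topCoeff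
  rw [frame_eq_realBasis]
  exact right_ne_zero_of_mul hp.ne'

lemma contDiff_topCoeff : ContDiff ℝ ∞ (topCoeff : (E →L[ℝ] E →L[ℝ] ℝ) → ℝ) := by
  unfold topCoeff wedgePow
  refine contDiff_const.mul (ContDiff.sum fun σ _ => contDiff_const.mul ?_)
  refine contDiff_prod fun i _ => ?_
  exact (contDiff_id.clm_apply contDiff_const).clm_apply contDiff_const

end TopPower

/-! ### Coordinate expressions and independence of the chart. -/

section Charts

variable {E : Type*} [NormedAddCommGroup E] [NormedSpace ℂ E]
  {M : Type*} [TopologicalSpace M] [ChartedSpace E M]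

/-- Tangent vectors are read in the preferred chart, so no chart change appears; this and the two
variants below are the bridge to the flat calculus. -/
lemma mfderiv_real_eq_fderiv {G : Type*} [NormedAddCommGroup G] [NormedSpace ℝ G] {f : M → G}
    {p : M} (hf : MDifferentiableAt 𝓘(ℝ, E) 𝓘(ℝ, G) f p) :
    (mfderiv 𝓘(ℝ, E) 𝓘(ℝ, G) f p : E →L[ℝ] G) =
      fderiv ℝ (f ∘ (chartAt E p).symm) (chartAt E p p) := by
  refine hf.mfderiv.trans ?_
  simp only [writtenInExtChartAt, extChartAt, mfld_simps, fderivWithin_univ]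
  rfl

lemma mfderiv_self_eq_fderiv {N : Type*} [TopologicalSpace N] [ChartedSpace E N] {f : M → N}
    {p : M} (hf : MDifferentiableAt 𝓘(ℝ, E) 𝓘(ℝ, E) f p) :
    (mfderiv 𝓘(ℝ, E) 𝓘(ℝ, E) f p : E →L[ℝ] E) =
      fderiv ℝ (chartAt E (f p) ∘ f ∘ (chartAt E p).symm) (chartAt E p p) := by
  refine hf.mfderiv.trans ?_
  simp only [writtenInExtChartAt, extChartAt, mfld_simps, fderivWithin_univ]
  rfl

lemma mfderiv_symm_eq_fderiv {g : E → M}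
    {x : E} (hf : MDifferentiableAt 𝓘(ℝ, E) 𝓘(ℝ, E) g x) :
    (mfderiv 𝓘(ℝ, E) 𝓘(ℝ, E) g x : E →L[ℝ] E) =
      fderiv ℝ (chartAt E (g x) ∘ g) x := by
  refine hf.mfderiv.trans ?_
  simp only [writtenInExtChartAt, extChartAt, mfld_simps, fderivWithin_univ]
  rfl

lemma IsSmooth.add {f g : M → ℝ} (hf : IsSmooth E f) (hg : IsSmooth E g) :
    IsSmooth E (f + g) :=
  ContMDiff.add hf hg

lemma IsSmooth.const_smul {f : M → ℝ} (c : ℝ) (hf : IsSmooth E f) : IsSmooth E (c • f) :=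
  ContMDiff.mul (contMDiff_const (c := c)) hf

lemma isSmooth_const (c : ℝ) : IsSmooth E (fun _ : M => c) :=
  contMDiff_const

variable [IsManifold 𝓘(ℂ, E) ω M]

lemma contDiffOn_transition {e e' : OpenPartialHomeomorph M E} (he : e ∈ atlas E M)
    (he' : e' ∈ atlas E M) : ContDiffOn ℂ ω (e' ∘ e.symm) (e.symm ≫ₕ e').source := by
  have h := StructureGroupoid.compatible (contDiffGroupoid ω 𝓘(ℂ, E)) he he'
  have := (mem_groupoid_of_pregroupoid.1 h).1
  simpa [contDiffPregroupoid] using this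

variable (E M) in
lemma isManifold_real : IsManifold 𝓘(ℝ, E) ∞ M := by
  refine isManifold_of_contDiffOn _ _ _ fun e e' he he' => ?_
  have := ((contDiffOn_transition he he').restrict_scalars ℝ).of_le (m := ∞) le_top
  simpa using this

variable (E M) in
lemma isManifold_real_one : IsManifold 𝓘(ℝ, E) 1 M :=
  have := isManifold_real E M
  IsManifold.of_le (n := ∞) (by simp)

/-- The coordinate expression of a smooth function. -/
lemma IsSmooth.contDiffOn {f : M → ℝ} (hf : IsSmooth E f) {e : OpenPartialHomeomorph M E}
    (he : e ∈ atlas E M) : ContDiffOn ℝ ∞ (f ∘ e.symm) e.target := by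
  have := isManifold_real E M
  have h := contMDiffOn_symm_of_mem_maximalAtlas (I := 𝓘(ℝ, E)) (n := ∞)
    (IsManifold.subset_maximalAtlas he)
  exact contMDiffOn_iff_contDiffOn.1 (ContMDiff.comp_contMDiffOn hf h)

lemma isSmooth_of_contDiffOn {f : M → ℝ}
    (hf : ∀ p, ContDiffOn ℝ ∞ (f ∘ (chartAt E p).symm) (chartAt E p).target) : IsSmooth E f := by
  have := isManifold_real E M
  intro p
  have h1 : ContMDiffAt 𝓘(ℝ, E) 𝓘(ℝ, E) ∞ (chartAt E p) p := by
    have := contMDiffOn_of_mem_maximalAtlas (I := 𝓘(ℝ, E)) (n := ∞) (M := M)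
      (IsManifold.subset_maximalAtlas (chart_mem_atlas E p))
    exact this.contMDiffAt ((chartAt E p).open_source.mem_nhds (mem_chart_source E p))
  have h2 := ((hf p).contDiffAt ((chartAt E p).open_target.mem_nhds
    (mem_chart_target E p))).contMDiffAt
  refine (h2.comp p h1).congr_of_eventuallyEq ?_
  filter_upwards [(chartAt E p).open_source.mem_nhds (mem_chart_source E p)] with q hq
  simp [(chartAt E p).left_inv hq]

section Atlas

variable {e : OpenPartialHomeomorph M E} (he : e ∈ atlas E M)
include he

lemma mfderiv_chart {q : M} (hq : q ∈ e.source) :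
    (mfderiv 𝓘(ℝ, E) 𝓘(ℝ, E) e q : E →L[ℝ] E) =
      fderiv ℝ (e ∘ (chartAt E q).symm) (chartAt E q q) := by
  have := isManifold_real_one E M
  exact mfderiv_real_eq_fderiv (mdifferentiableAt_atlas he hq)

lemma mfderiv_chart_symm {x : E} (hx : x ∈ e.target) :
    (mfderiv 𝓘(ℝ, E) 𝓘(ℝ, E) e.symm x : E →L[ℝ] E) =
      fderiv ℝ (chartAt E (e.symm x) ∘ e.symm) x := by
  have := isManifold_real_one E M
  exact mfderiv_symm_eq_fderiv (mdifferentiableAt_atlas_symm he hx)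

lemma chartForm_eq (Ω : TwoForm E M) {x : E} (hx : x ∈ e.target) :
    chartForm e Ω x = (Ω (e.symm x)).bilinearComp (fderiv ℝ (chartAt E (e.symm x) ∘ e.symm) x)
      (fderiv ℝ (chartAt E (e.symm x) ∘ e.symm) x) :=
  congrArg (fun A : E →L[ℝ] E => (Ω (e.symm x)).bilinearComp A A) (mfderiv_chart_symm he hx)

lemma differentiableAt_transition {e' : OpenPartialHomeomorph M E} (he' : e' ∈ atlas E M) {x : E}
    (hx : x ∈ e.target) (hx' : e.symm x ∈ e'.source) : DifferentiableAt ℂ (e' ∘ e.symm) x :=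
  ((contDiffOn_transition he he').contDiffAt
    ((e.symm ≫ₕ e').open_source.mem_nhds (by simp [hx, hx']))).differentiableAt (by simp)

/-- The reverse transition map is a local inverse, so by the chain rule the two determinants have
product `1`. -/
lemma det_fderiv_transition_ne_zero {x : E} (hx : x ∈ e.target) :
    LinearMap.det (fderiv ℝ (chartAt E (e.symm x) ∘ e.symm) x : E →ₗ[ℝ] E) ≠ 0 := by
  set c := chartAt E (e.symm x) with hc
  have hsrc : e.symm x ∈ c.source := mem_chart_source E _
  have hcm : c ∈ atlas E M := chart_mem_atlas E _
  have d1 := (differentiableAt_transition he hcm hx hsrc).restrictScalars ℝ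
  have hx' : e.symm x = c.symm (c (e.symm x)) := (c.left_inv hsrc).symm
  have d2 := (differentiableAt_transition hcm he (x := c (e.symm x)) (c.map_source hsrc)
    (by rw [← hx']; exact e.map_target hx)).restrictScalars ℝ
  have hcomp : (e ∘ c.symm) ∘ (c ∘ e.symm) =ᶠ[𝓝 x] id := by
    filter_upwards [(e.symm ≫ₕ c).open_source.mem_nhds (x := x) (by simp [hx, hsrc])] with y hy
    simp only [OpenPartialHomeomorph.trans_source, OpenPartialHomeomorph.symm_source,
      Set.mem_inter_iff, Set.mem_preimage] at hy
    simp [c.left_inv hy.2, e.right_inv hy.1]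
  have h := hcomp.fderiv_eq (𝕜 := ℝ)
  rw [fderiv_comp x d2 d1, fderiv_id] at h
  have h' := congrArg (fun A : E →L[ℝ] E => LinearMap.det (A : E →ₗ[ℝ] E)) h
  simp only [ContinuousLinearMap.toLinearMap_comp, LinearMap.det_comp, ContinuousLinearMap.coe_id,
    LinearMap.det_id] at h'
  exact right_ne_zero_of_mul (h'.trans_ne one_ne_zero)

lemma dirDeriv_eq_fderiv {f : M → ℝ} (hf : IsSmooth E f) (X : VectorField E M) {x : E}
    (hx : x ∈ e.target) :
    dirDeriv X f (e.symm x) = fderiv ℝ (f ∘ e.symm) x (chartField e X x) := by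
  have := isManifold_real_one E M
  have hs := e.map_target hx
  have hfe : f =ᶠ[𝓝 (e.symm x)] (f ∘ e.symm) ∘ e := by
    filter_upwards [e.open_source.mem_nhds hs] with q hq
    simp [e.left_inv hq]
  have d : DifferentiableAt ℝ (f ∘ e.symm) (e (e.symm x)) := by
    rw [e.right_inv hx]
    exact differentiableAt_of_contDiffOn e.open_target (hf.contDiffOn he) hx
  rw [dirDeriv, hfe.mfderiv_eq, mfderiv_comp (e.symm x) d.mdifferentiableAt
    (mdifferentiableAt_atlas he hs), mfderiv_eq_fderiv, e.right_inv hx]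
  rfl

/-- The transition from the preferred chart to `e` is holomorphic, so its derivative commutes with
`i`. -/
lemma chartField_rotate (X : VectorField E M) {x : E} (hx : x ∈ e.target) :
    chartField e (rotate X) x = Complex.I • chartField e X x := by
  unfold chartField
  have hs := e.map_target hx
  rw [mfderiv_chart he hs]
  have hd := differentiableAt_transition (chart_mem_atlas E (e.symm x)) he
    (mem_chart_target E (e.symm x)) (by rwa [(chartAt E _).left_inv (mem_chart_source E _)])
  rw [hd.fderiv_restrictScalars ℝ]
  exact map_smul (fderiv ℂ (e ∘ (chartAt E (e.symm x)).symm) _) Complex.I (X (e.symm x))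

/-- The coordinate expression of `i∂∂̄f`. -/
lemma chartForm_ddbar {f : M → ℝ} (hf : IsSmooth E f) {x : E} (hx : x ∈ e.target) :
    chartForm e (ddbar f) x = ddbarFlat (f ∘ e.symm) x := by
  set c := chartAt E (e.symm x) with hc
  have hsrc : e.symm x ∈ c.source := mem_chart_source E _
  have hcm : c ∈ atlas E M := chart_mem_atlas E _
  have ht := contDiffOn_transition he hcm
  have hmaps : Set.MapsTo (c ∘ e.symm) (e.symm ≫ₕ c).source c.target := by
    intro y hy
    simp only [OpenPartialHomeomorph.trans_source, OpenPartialHomeomorph.symm_source,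
      Set.mem_inter_iff, Set.mem_preimage] at hy
    exact c.map_source hy.2
  have hxs : x ∈ (e.symm ≫ₕ c).source := by simp [hx, hsrc]
  -- `ddbar f` is defined through the preferred chart `c`; factoring through the holomorphic
  -- transition reduces the claim to `ddbarFlat_comp`.
  have hcongr : f ∘ e.symm =ᶠ[𝓝 x] (f ∘ c.symm) ∘ (c ∘ e.symm) := by
    filter_upwards [(e.symm ≫ₕ c).open_source.mem_nhds hxs] with y hy
    simp only [OpenPartialHomeomorph.trans_source, OpenPartialHomeomorph.symm_source,
      Set.mem_inter_iff, Set.mem_preimage] at hy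
    simp [c.left_inv hy.2]
  ext u v
  rw [ddbarFlat_congr hcongr, ddbarFlat_comp (e.symm ≫ₕ c).open_source c.open_target
    ((ht.restrict_scalars ℝ).of_le le_top) (ht.differentiableOn (by simp)) hmaps
    (hf.contDiffOn hcm) hxs]
  rw [chartForm_eq he _ hx]
  rfl

lemma topCoeff_chartForm [FiniteDimensional ℂ E] (Ω : TwoForm E M) {x : E}
    (hx : x ∈ e.target) : topCoeff (chartForm e Ω x) =
      LinearMap.det (fderiv ℝ (chartAt E (e.symm x) ∘ e.symm) x : E →ₗ[ℝ] E) *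
        topCoeff (Ω (e.symm x)) := by
  rw [chartForm_eq he Ω hx, topCoeff_bilinearComp]

/-- The quotient of two volume forms may be computed in any chart. -/
lemma volumeRatio_eq_chartForm [FiniteDimensional ℂ E] (Ω' Ω : TwoForm E M) {x : E}
    (hx : x ∈ e.target) : volumeRatio Ω' Ω (e.symm x) =
      topCoeff (chartForm e Ω' x) / topCoeff (chartForm e Ω x) := by
  rw [topCoeff_chartForm he _ hx, topCoeff_chartForm he _ hx,
    mul_div_mul_left _ _ (det_fderiv_transition_ne_zero he hx), volumeRatio]

end Atlas

end Charts

/-! ### Derivatives along `X`, `i∂∂̄`, and Ricci forms on `M`. -/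

section Calculus

variable {E : Type*} [NormedAddCommGroup E] [NormedSpace ℂ E]
  {M : Type*} [TopologicalSpace M] [ChartedSpace E M] [IsManifold 𝓘(ℂ, E) ω M]

lemma ddbar_add {f g : M → ℝ} (hf : IsSmooth E f) (hg : IsSmooth E g) :
    ddbar (E := E) (f + g) = ddbar f + ddbar g := by
  ext1 p
  exact ddbarFlat_add (chartAt E p).open_target (hf.contDiffOn (chart_mem_atlas E p))
    (hg.contDiffOn (chart_mem_atlas E p)) (mem_chart_target E p)

lemma ddbar_const_smul (c : ℝ) {f : M → ℝ} (hf : IsSmooth E f) :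
    ddbar (E := E) (c • f) = c • ddbar f := by
  ext1 p
  exact ddbarFlat_const_smul c (chartAt E p).open_target (hf.contDiffOn (chart_mem_atlas E p))
    (mem_chart_target E p)

omit [IsManifold 𝓘(ℂ, E) ω M] in
lemma ddbar_const (c : ℝ) : ddbar (E := E) (fun _ : M => c) = 0 := by
  ext p u v
  have h : (fun _ : M => c) ∘ (chartAt E p).symm = fun _ => c := rfl
  have h' : fderiv ℝ (fun _ : E => c) = 0 := by ext1; simp
  rw [ddbar, ddbarFlat_apply, h, h']
  simp

lemma dirDeriv_chartAt {f : M → ℝ} (hf : IsSmooth E f) (X : VectorField E M) (p : M) :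
    dirDeriv X f p = fderiv ℝ (f ∘ (chartAt E p).symm) (chartAt E p p)
      (chartField (chartAt E p) X (chartAt E p p)) := by
  have := dirDeriv_eq_fderiv (chart_mem_atlas E p) hf X (mem_chart_target E p)
  rwa [(chartAt E p).left_inv (mem_chart_source E p)] at this

lemma dirDeriv_add {f g : M → ℝ} (hf : IsSmooth E f) (hg : IsSmooth E g) (X : VectorField E M) :
    dirDeriv X (f + g) = dirDeriv X f + dirDeriv X g := by
  ext1 p
  have d : ∀ {h : M → ℝ}, IsSmooth E h → DifferentiableAt ℝ (h ∘ (chartAt E p).symm)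
      (chartAt E p p) := fun hh => differentiableAt_of_contDiffOn (chartAt E p).open_target
        (hh.contDiffOn (chart_mem_atlas E p)) (mem_chart_target E p)
  rw [Pi.add_apply, dirDeriv_chartAt (hf.add hg), dirDeriv_chartAt hf, dirDeriv_chartAt hg,
    ← add_apply, ← fderiv_add (d hf) (d hg)]
  rfl

lemma dirDeriv_const_smul (c : ℝ) {f : M → ℝ} (hf : IsSmooth E f) (X : VectorField E M) :
    dirDeriv X (c • f) = c • dirDeriv X f := by
  ext1 p
  have d : DifferentiableAt ℝ (f ∘ (chartAt E p).symm)
      (chartAt E p p) := differentiableAt_of_contDiffOn (chartAt E p).open_target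
        (hf.contDiffOn (chart_mem_atlas E p)) (mem_chart_target E p)
  rw [Pi.smul_apply, dirDeriv_chartAt (hf.const_smul c), dirDeriv_chartAt hf,
    ← smul_apply, ← fderiv_const_smul d]
  rfl

lemma dirDeriv_const (c : ℝ) (X : VectorField E M) : dirDeriv X (fun _ : M => c) = 0 := by
  ext1 p
  rw [dirDeriv_chartAt (isSmooth_const c)]
  have h : (fun _ : M => c) ∘ (chartAt E p).symm = fun _ => c := rfl
  simp [h]

section HolomorphicField

variable {X : VectorField E M} (hX : IsRealHolomorphic X) {f : M → ℝ} (hf : IsSmooth E f)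
include hX hf

lemma isSmooth_dirDeriv : IsSmooth E (dirDeriv X f) := by
  refine isSmooth_of_contDiffOn fun p => ?_
  have he := chart_mem_atlas E p
  refine (contDiffOn_fderiv_apply (chartAt E p).open_target (hX.smooth _ he)
    (hf.contDiffOn he)).congr fun x hx => ?_
  exact dirDeriv_eq_fderiv he hf X hx

omit hX in
lemma dirDeriv_comp_symm_eventuallyEq (p : M) :
    dirDeriv X f ∘ (chartAt E p).symm =ᶠ[𝓝 (chartAt E p p)] fun x =>
      fderiv ℝ (f ∘ (chartAt E p).symm) x (chartField (chartAt E p) X x) := by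
  filter_upwards [(chartAt E p).open_target.mem_nhds (mem_chart_target E p)] with x hx
  exact dirDeriv_eq_fderiv (chart_mem_atlas E p) hf X hx

/-- `L_X (Ω + i∂∂̄f) = L_X Ω + i∂∂̄(X · f)` for a real holomorphic vector field `X`. -/
lemma lieDeriv_add_ddbar {Ω : TwoForm E M}
    (hΩ : ∀ e ∈ atlas E M, ContDiffOn ℝ ∞ (chartForm e Ω) e.target) :
    lieDeriv X (Ω + ddbar f) = lieDeriv X Ω + ddbar (dirDeriv X f) := by
  ext1 p
  have he := chart_mem_atlas E p
  have ho := (chartAt E p).open_target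
  have hx := mem_chart_target E p
  rw [Pi.add_apply, ddbar, ddbarFlat_congr (dirDeriv_comp_symm_eventuallyEq hf p),
    ← lieFlat_ddbarFlat ho (hX.smooth _ he) (hf.contDiffOn he) (hX.holomorphic _ he) hx]
  have h : chartForm (chartAt E p) (Ω + ddbar f) =ᶠ[𝓝 (chartAt E p p)]
      chartForm (chartAt E p) Ω + ddbarFlat (f ∘ (chartAt E p).symm) := by
    filter_upwards [ho.mem_nhds hx] with x hx
    rw [Pi.add_apply, ← chartForm_ddbar he hf hx]
    rfl
  ext u v
  simp only [lieDeriv, lieFlat_apply, add_apply]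
  rw [h.fderiv_eq, h.eq_of_nhds, fderiv_add
    (differentiableAt_of_contDiffOn ho (hΩ _ he) hx)
    (differentiableAt_of_contDiffOn ho (contDiffOn_ddbarFlat ho (hf.contDiffOn he)) hx)]
  simp only [add_apply, Pi.add_apply]
  ring

omit hX in
lemma fderiv_I_smul_chartField (hJ : ∀ p, dirDeriv (rotate X) f p = 0)
    {e : OpenPartialHomeomorph M E} (he : e ∈ atlas E M) :
    ∀ x ∈ e.target, fderiv ℝ (f ∘ e.symm) x (Complex.I • chartField e X x) = 0 := by
  intro x hx
  rw [← chartField_rotate he X hx, ← dirDeriv_eq_fderiv he hf _ hx, hJ]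

/-- If `f` is invariant under `JX`, then so is `X · f`. -/
lemma dirDeriv_rotate_dirDeriv (hJ : ∀ p, dirDeriv (rotate X) f p = 0) (p : M) :
    dirDeriv (rotate X) (dirDeriv X f) p = 0 := by
  have he := chart_mem_atlas E p
  have hx := mem_chart_target E p
  rw [dirDeriv_chartAt (isSmooth_dirDeriv hX hf), chartField_rotate he X hx,
    (dirDeriv_comp_symm_eventuallyEq hf p).fderiv_eq]
  exact fderiv_I_smul_field_fderiv_apply (chartAt E p).open_target (hX.smooth _ he)
    (hf.contDiffOn he) (hX.holomorphic _ he) (fderiv_I_smul_chartField hf hJ he) hx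

/-- If `f` is pluriharmonic and invariant under `JX`, then `X · f` is constant. -/
lemma exists_dirDeriv_eq_const [ConnectedSpace M] (hJ : ∀ p, dirDeriv (rotate X) f p = 0)
    (hdd : ddbar (E := E) f = 0) : ∃ c : ℝ, ∀ p, dirDeriv X f p = c := by
  have hloc : IsLocallyConstant (dirDeriv X f) := by
    rw [IsLocallyConstant.iff_eventually_eq]
    intro p
    set e := chartAt E p
    have he : e ∈ atlas E M := chart_mem_atlas E p
    have hx : e p ∈ e.target := mem_chart_target E p
    have hp : p ∈ e.source := mem_chart_source E p
    -- The chart target may be disconnected; on a ball a vanishing derivative forces constancy.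
    obtain ⟨r, hr, hball⟩ := Metric.isOpen_iff.1 e.open_target _ hx
    have hd : ∀ y ∈ Metric.ball (e p) r,
        fderiv ℝ (fun x => fderiv ℝ (f ∘ e.symm) x (chartField e X x)) y = 0 := by
      intro y hy
      refine fderiv_fderiv_apply_eq_zero e.open_target (hX.smooth _ he) (hf.contDiffOn he)
        (hX.holomorphic _ he) (fderiv_I_smul_chartField hf hJ he) (hball hy) ?_
      rw [← chartForm_ddbar he hf (hball hy), hdd, chartForm_eq he _ (hball hy)]
      ext
      simp
    have hdiff : DifferentiableOn ℝ (fun x => fderiv ℝ (f ∘ e.symm) x (chartField e X x))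
        (Metric.ball (e p) r) :=
      ((contDiffOn_fderiv_apply e.open_target (hX.smooth _ he) (hf.contDiffOn he)).mono
        hball).differentiableOn (by simp)
    have hev : e ⁻¹' Metric.ball (e p) r ∈ 𝓝 p :=
      (e.continuousAt hp).preimage_mem_nhds (Metric.ball_mem_nhds _ hr)
    filter_upwards [hev, e.open_source.mem_nhds hp] with q hq hqs
    have h := Metric.isOpen_ball.is_const_of_fderiv_eq_zero
      (convex_ball (e p) r).isPreconnected hdiff hd hq (Metric.mem_ball_self hr)
    have h1 := dirDeriv_eq_fderiv he hf X (hball hq)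
    have h2 := dirDeriv_eq_fderiv he hf X hx
    rw [e.left_inv hqs] at h1
    rw [e.left_inv hp] at h2
    rw [h1, h2]
    exact h
  obtain ⟨p₀⟩ := (inferInstance : Nonempty M)
  exact ⟨dirDeriv X f p₀, fun p => hloc.apply_eq_of_isPreconnected isPreconnected_univ
    (Set.mem_univ p) (Set.mem_univ p₀)⟩

end HolomorphicField

section Volume

variable [FiniteDimensional ℂ E]

/-- Smooth 2-forms whose top power vanishes nowhere. -/
structure IsNondegenerate (Ω : TwoForm E M) : Prop where
  smooth : ∀ e ∈ atlas E M, ContDiffOn ℝ ∞ (chartForm e Ω) e.target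
  topCoeff_ne_zero : ∀ p, topCoeff (Ω p) ≠ 0

omit [IsManifold 𝓘(ℂ, E) ω M] in
lemma IsKahlerForm.isNondegenerate {Ω : TwoForm E M} (hΩ : IsKahlerForm Ω) :
    IsNondegenerate Ω :=
  ⟨hΩ.smooth, fun p => topCoeff_ne_zero (hΩ.alternating p) (hΩ.typeOneOne p) (hΩ.positive p)⟩

/-- Symmetry of the Hessian makes `i∂∂̄f` alternating, and it is of type `(1,1)`; with positivity
the linear algebra of `topCoeff_ne_zero` applies. -/
lemma IsKahlerForm.isNondegenerate_add_ddbar {Ω : TwoForm E M} (hΩ : IsKahlerForm Ω) {f : M → ℝ}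
    (hf : IsSmooth E f) (hpos : IsPositive (Ω + ddbar f)) : IsNondegenerate (Ω + ddbar f) := by
  refine ⟨fun e he => ?_, fun p => topCoeff_ne_zero (fun u => ?_) (fun u v => ?_) (hpos p)⟩
  · refine ((hΩ.smooth e he).add
      (contDiffOn_ddbarFlat e.open_target (hf.contDiffOn he))).congr fun x hx => ?_
    rw [← chartForm_ddbar he hf hx]
    rfl
  · have hs := isSymmSndFDerivAt_of_contDiffOn (chartAt E p).open_target
      (hf.contDiffOn (chart_mem_atlas E p)) (mem_chart_target E p)
    rw [Pi.add_apply, add_apply, add_apply, hΩ.alternating p u, ddbar, ddbarFlat_self _ hs,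
      add_zero]
  · simp only [Pi.add_apply, add_apply, hΩ.typeOneOne, ddbar, ddbarFlat_I_I]

section Ratio

variable {Ω' Ω : TwoForm E M} (h' : IsNondegenerate Ω') (h : IsNondegenerate Ω)
include h' h

omit h' in
lemma topCoeff_chartForm_ne_zero {e : OpenPartialHomeomorph M E} (he : e ∈ atlas E M) {x : E}
    (hx : x ∈ e.target) : topCoeff (chartForm e Ω x) ≠ 0 := by
  rw [topCoeff_chartForm he Ω hx]
  exact mul_ne_zero (det_fderiv_transition_ne_zero he hx) (h.topCoeff_ne_zero _)

omit h' in
lemma contDiffOn_log_topCoeff {e : OpenPartialHomeomorph M E} (he : e ∈ atlas E M) :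
    ContDiffOn ℝ ∞ (fun x => Real.log (topCoeff (chartForm e Ω x))) e.target :=
  (contDiff_topCoeff.comp_contDiffOn (h.smooth e he)).log
    fun _ hx => topCoeff_chartForm_ne_zero h he hx

lemma log_volumeRatio_eq {e : OpenPartialHomeomorph M E} (he : e ∈ atlas E M) {x : E}
    (hx : x ∈ e.target) : Real.log (volumeRatio Ω' Ω (e.symm x)) =
      Real.log (topCoeff (chartForm e Ω' x)) - Real.log (topCoeff (chartForm e Ω x)) := by
  rw [volumeRatio_eq_chartForm he _ _ hx, Real.log_div (topCoeff_chartForm_ne_zero h' he hx)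
    (topCoeff_chartForm_ne_zero h he hx)]

lemma isSmooth_log_volumeRatio : IsSmooth E fun p => Real.log (volumeRatio Ω' Ω p) := by
  refine isSmooth_of_contDiffOn fun p => ?_
  have he := chart_mem_atlas E p
  exact ((contDiffOn_log_topCoeff h' he).sub (contDiffOn_log_topCoeff h he)).congr
    fun x hx => log_volumeRatio_eq h' h he hx

/-- Two Ricci forms differ by `i∂∂̄` of the logarithm of the volume ratio. -/
lemma ricciForm_eq_sub : ricciForm Ω' =
    ricciForm Ω - ddbar (fun p => Real.log (volumeRatio Ω' Ω p)) := by
  ext1 p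
  have he := chart_mem_atlas E p
  have ho := (chartAt E p).open_target
  have hx := mem_chart_target E p
  have hev : (fun x => Real.log (topCoeff (chartForm (chartAt E p) Ω' x)))
      =ᶠ[𝓝 (chartAt E p p)] (fun x => Real.log (topCoeff (chartForm (chartAt E p) Ω x))) +
        (fun q => Real.log (volumeRatio Ω' Ω q)) ∘ (chartAt E p).symm := by
    filter_upwards [ho.mem_nhds hx] with x hx
    simp only [Pi.add_apply, Function.comp_apply]
    rw [log_volumeRatio_eq h' h he hx]
    ring
  rw [Pi.sub_apply, ricciForm, ricciForm, ddbarFlat_congr hev,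
    ddbarFlat_add ho (contDiffOn_log_topCoeff h he)
      ((isSmooth_log_volumeRatio h' h).contDiffOn he) hx, ddbar]
  ext u v
  simp only [neg_apply, add_apply, sub_apply]
  ring

end Ratio

end Volume

end Calculus

/-! ### One-parameter subgroups of the torus and invariance. -/

lemma torusExp_add {k : ℕ} (b c : Fin k → ℝ) : torusExp (b + c) = torusExp b * torusExp c := by
  ext1 j
  simp [torusExp, Circle.exp_add]

lemma torusExp_zero {k : ℕ} : torusExp (0 : Fin k → ℝ) = 1 := by
  ext1 j
  simp [torusExp]

section Torus

variable {E : Type*} [NormedAddCommGroup E] [NormedSpace ℂ E]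
  {M : Type*} [TopologicalSpace M] [ChartedSpace E M]
  {k : ℕ} [MulAction (Fin k → Circle) M] (hT : IsHolomorphicTorusAction E M k)
include hT

lemma contMDiff_torusExp_smul (b : Fin k → ℝ) :
    ContMDiff 𝓘(ℝ, E) 𝓘(ℝ, E) ∞ (fun q : M => torusExp b • q) :=
  hT.smooth.comp ((contMDiff_const (c := b)).prodMk contMDiff_id)

lemma contMDiff_torus_orbit (b : Fin k → ℝ) (p : M) :
    ContMDiff 𝓘(ℝ, ℝ) 𝓘(ℝ, E) ∞ (fun s : ℝ => torusExp (s • b) • p) := by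
  have h : ContMDiff 𝓘(ℝ, ℝ) 𝓘(ℝ, Fin k → ℝ) ∞ (fun s : ℝ => s • b) :=
    ContDiff.contMDiff (contDiff_id.smul contDiff_const)
  exact hT.smooth.comp (h.prodMk (contMDiff_const (c := p)))

lemma hasDerivAt_torus_orbit_zero {b : Fin k → ℝ} {Y : VectorField E M}
    (hY : ∀ p : M, Y p =
      (mfderiv 𝓘(ℝ, ℝ) 𝓘(ℝ, E) (fun s : ℝ => torusExp (s • b) • p) 0 : ℝ →L[ℝ] E) 1)
    {f : M → ℝ} (hf : IsSmooth E f) (p : M) :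
    HasDerivAt (fun s : ℝ => f (torusExp (s • b) • p)) (dirDeriv Y f p) 0 := by
  have hγ : MDifferentiableAt 𝓘(ℝ, ℝ) 𝓘(ℝ, E) (fun s : ℝ => torusExp (s • b) • p) 0 :=
    (contMDiff_torus_orbit hT b p 0).mdifferentiableAt (by simp)
  have h0 : torusExp ((0 : ℝ) • b) • p = p := by rw [zero_smul, torusExp_zero, one_smul]
  have hfd : MDifferentiableAt 𝓘(ℝ, E) 𝓘(ℝ, ℝ) f (torusExp ((0 : ℝ) • b) • p) :=
    ContMDiffAt.mdifferentiableAt (hf _) (by simp)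
  -- The differential is taken at `torusExp (0 • b) • p`, which is `p` only after rewriting; plain
  -- maps between model spaces avoid tangent spaces depending on the base point.
  obtain ⟨A, hA⟩ : ∃ A : E →L[ℝ] ℝ,
      A = mfderiv 𝓘(ℝ, E) 𝓘(ℝ, ℝ) f (torusExp ((0 : ℝ) • b) • p) := ⟨_, rfl⟩
  obtain ⟨B, hB⟩ : ∃ B : ℝ →L[ℝ] E,
      B = mfderiv 𝓘(ℝ, ℝ) 𝓘(ℝ, E) (fun s : ℝ => torusExp (s • b) • p) 0 := ⟨_, rfl⟩
  have h : HasFDerivAt (fun s : ℝ => f (torusExp (s • b) • p)) (A.comp B) 0 := by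
    rw [hA, hB]
    exact hasMFDerivAt_iff_hasFDerivAt.1 (hfd.hasMFDerivAt.comp (0 : ℝ) hγ.hasMFDerivAt)
  have hAp : A (Y p) = dirDeriv Y f p := by
    rw [dirDeriv, hA]
    congr 2
  have hBp : B 1 = Y p := by
    rw [hY, hB]
    rfl
  rw [← hAp, ← hBp]
  exact h.hasDerivAt

/-- By the group law, the orbit of `p` near time `s` is the orbit of `exp(sb)p` near time `0`. -/
lemma hasDerivAt_torus_orbit {b : Fin k → ℝ} {Y : VectorField E M}
    (hY : ∀ p : M, Y p =
      (mfderiv 𝓘(ℝ, ℝ) 𝓘(ℝ, E) (fun s : ℝ => torusExp (s • b) • p) 0 : ℝ →L[ℝ] E) 1)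
    {f : M → ℝ} (hf : IsSmooth E f) (p : M) (s : ℝ) :
    HasDerivAt (fun s : ℝ => f (torusExp (s • b) • p)) (dirDeriv Y f (torusExp (s • b) • p)) s := by
  have h := hasDerivAt_torus_orbit_zero hT hY hf (torusExp (s • b) • p)
  rw [← sub_self s] at h
  have h' := h.comp_sub_const s s
  refine h'.congr_of_eventuallyEq (Filter.Eventually.of_forall fun r => ?_)
  simp only [smul_smul, ← torusExp_add, ← add_smul, sub_add_cancel]

/-- A function with `Y · f = 0` is invariant under the one-parameter group of `Y`. -/
lemma torus_orbit_invariant {b : Fin k → ℝ} {Y : VectorField E M}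
    (hY : ∀ p : M, Y p =
      (mfderiv 𝓘(ℝ, ℝ) 𝓘(ℝ, E) (fun s : ℝ => torusExp (s • b) • p) 0 : ℝ →L[ℝ] E) 1)
    {f : M → ℝ} (hf : IsSmooth E f) (hYf : ∀ p, dirDeriv Y f p = 0) (p : M) (s : ℝ) :
    f (torusExp (s • b) • p) = f p := by
  have hd := hasDerivAt_torus_orbit hT hY hf p
  have h := is_const_of_deriv_eq_zero (fun r => (hd r).differentiableAt)
    (fun r => by rw [(hd r).deriv, hYf]) s 0
  simpa [torusExp_zero] using h

variable [IsManifold 𝓘(ℂ, E) ω M]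

/-- `i∂∂̄f` is invariant under the torus elements that leave `f` invariant. -/
lemma ddbar_torusExp_smul {f : M → ℝ} (hf : IsSmooth E f) (b : Fin k → ℝ)
    (hft : ∀ p, f (torusExp b • p) = f p) (p : M) :
    ddbar (E := E) f p = (ddbar (E := E) f (torusExp b • p)).bilinearComp
      (mfderiv 𝓘(ℝ, E) 𝓘(ℝ, E) (fun q : M => torusExp b • q) p : E →L[ℝ] E)
      (mfderiv 𝓘(ℝ, E) 𝓘(ℝ, E) (fun q : M => torusExp b • q) p : E →L[ℝ] E) := by
  have hm : (mfderiv 𝓘(ℝ, E) 𝓘(ℝ, E) (fun q : M => torusExp b • q) p : E →L[ℝ] E) = _ :=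
    mfderiv_self_eq_fderiv ((contMDiff_torusExp_smul hT b p).mdifferentiableAt (by simp))
  refine Eq.trans ?_ (congrArg (fun A : E →L[ℝ] E =>
    (ddbar (E := E) f (torusExp b • p)).bilinearComp A A) hm.symm)
  set c := chartAt E p with hc
  set c' := chartAt E (torusExp b • p) with hc'
  set τ : M → M := fun q => torusExp b • q with hτ
  have hhol : ContMDiff 𝓘(ℂ, E) 𝓘(ℂ, E) ω τ := hT.holomorphic (torusExp b)
  have hcm : c ∈ atlas E M := chart_mem_atlas E _
  have hcm' : c' ∈ atlas E M := chart_mem_atlas E _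
  have hx : c p ∈ c.target := mem_chart_target E p
  have hp : c.symm (c p) = p := c.left_inv (mem_chart_source E p)
  have hcont : ContinuousOn (τ ∘ c.symm) c.target :=
    hhol.continuous.comp_continuousOn c.continuousOn_symm
  set U := c.target ∩ (τ ∘ c.symm) ⁻¹' c'.source with hUdef
  have hU : IsOpen U := hcont.isOpen_inter_preimage c.open_target c'.open_source
  have hxU : c p ∈ U := by
    refine ⟨hx, ?_⟩
    simp only [Set.mem_preimage, Function.comp_apply, hp]
    exact mem_chart_source E _
  have hg : ContDiffOn ℂ ω (c' ∘ τ ∘ c.symm) U := by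
    refine contMDiffOn_iff_contDiffOn.1 ?_
    have h1 := contMDiffOn_symm_of_mem_maximalAtlas (I := 𝓘(ℂ, E)) (n := ω)
      (IsManifold.subset_maximalAtlas hcm)
    have h2 := contMDiffOn_of_mem_maximalAtlas (I := 𝓘(ℂ, E)) (n := ω)
      (IsManifold.subset_maximalAtlas hcm')
    exact h2.comp (hhol.comp_contMDiffOn (h1.mono Set.inter_subset_left)) fun y hy => hy.2
  have hmaps : Set.MapsTo (c' ∘ τ ∘ c.symm) U c'.target := fun y hy => c'.map_source hy.2
  -- Invariance writes `f` as its own pullback by a holomorphic map, so `ddbarFlat_comp` applies.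
  have hev : f ∘ c.symm =ᶠ[𝓝 (c p)] (f ∘ c'.symm) ∘ (c' ∘ τ ∘ c.symm) := by
    filter_upwards [hU.mem_nhds hxU] with y hy
    have : c'.symm (c' (τ (c.symm y))) = τ (c.symm y) := c'.left_inv hy.2
    simp only [Function.comp_apply, this]
    exact (hft _).symm
  ext u v
  rw [ddbar, ← hc, ddbarFlat_congr hev, ddbarFlat_comp hU c'.open_target
    ((hg.restrict_scalars ℝ).of_le le_top) (hg.differentiableOn (by simp)) hmaps
    (hf.contDiffOn hcm') hxU]
  simp only [Function.comp_apply, hp]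
  rfl

variable [FiniteDimensional ℂ E]

/-- The volume ratio of two invariant forms is invariant. -/
lemma dirDeriv_log_volumeRatio {Y : VectorField E M} (hY : InTorusLieAlgebra k Y)
    {Ω : TwoForm E M} (hinv : IsTorusInvariant k Ω) (hΩ : IsNondegenerate Ω) {f : M → ℝ}
    (hf : IsSmooth E f) (hYf : ∀ p, dirDeriv Y f p = 0) (hΩ' : IsNondegenerate (Ω + ddbar f))
    (p : M) : dirDeriv Y (fun q => Real.log (volumeRatio (Ω + ddbar f) Ω q)) p = 0 := by
  obtain ⟨b, hb⟩ := hY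
  -- Both forms at `p` are pullbacks by the same differential `A`, whose determinant cancels; it is
  -- nonzero because `Ω p` is nondegenerate.
  have hratio : ∀ s : ℝ, volumeRatio (Ω + ddbar f) Ω (torusExp (s • b) • p) =
      volumeRatio (Ω + ddbar f) Ω p := by
    intro s
    let A : E →L[ℝ] E := mfderiv 𝓘(ℝ, E) 𝓘(ℝ, E) (fun q : M => torusExp (s • b) • q) p
    have h1 : Ω p = (Ω (torusExp (s • b) • p)).bilinearComp A A := by
      ext u v
      exact (hinv _ p u v).symm
    have h2 : (Ω + ddbar f : TwoForm E M) p =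
        ((Ω + ddbar f : TwoForm E M) (torusExp (s • b) • p)).bilinearComp A A := by
      have := ddbar_torusExp_smul hT hf (s • b)
        (fun q => torus_orbit_invariant hT hb hf hYf q s) p
      rw [Pi.add_apply, h1, this]
      rfl
    have hA : LinearMap.det (A : E →ₗ[ℝ] E) ≠ 0 := by
      have := hΩ.topCoeff_ne_zero p
      rw [h1, topCoeff_bilinearComp] at this
      exact left_ne_zero_of_mul this
    rw [volumeRatio, volumeRatio, h1, h2, topCoeff_bilinearComp, topCoeff_bilinearComp,
      mul_div_mul_left _ _ hA]
  have hd := hasDerivAt_torus_orbit_zero hT hb (isSmooth_log_volumeRatio hΩ' hΩ) p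
  simp only [hratio] at hd
  exact hd.unique (hasDerivAt_const _ _)

end Torus

/-! ### The Monge-Ampère expression and the soliton equation. -/

section Soliton

variable {E : Type*} [NormedAddCommGroup E] [NormedSpace ℂ E] [FiniteDimensional ℂ E]
  {M : Type*} [TopologicalSpace M] [ChartedSpace E M] [IsManifold 𝓘(ℂ, E) ω M]

/-- The left-hand side `log((Ω + i∂∂̄f)ⁿ / Ωⁿ) - ½ X · f + f` of the Monge-Ampère equation. -/
noncomputable def mongeAmpere (X : VectorField E M) (Ω : TwoForm E M) (f : M → ℝ) : M → ℝ :=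
  (fun p => Real.log (volumeRatio (Ω + ddbar f) Ω p)) + (-(1 / 2) : ℝ) • dirDeriv X f + f

variable {X : VectorField E M} (hX : IsRealHolomorphic X) {Ω : TwoForm E M} (hΩ : IsKahlerForm Ω)
  {f : M → ℝ} (hf : IsSmooth E f) (hpos : IsPositive (Ω + ddbar f))
include hX hΩ hf hpos

lemma isSmooth_mongeAmpere : IsSmooth E (mongeAmpere X Ω f) :=
  ((isSmooth_log_volumeRatio (hΩ.isNondegenerate_add_ddbar hf hpos) hΩ.isNondegenerate).add
    ((isSmooth_dirDeriv hX hf).const_smul _)).add hf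

/-- `i∂∂̄` of the Monge-Ampère expression measures the change of
`ρ + ½ L_X Ω - Ω` under `Ω ↦ Ω + i∂∂̄f`. -/
lemma ddbar_mongeAmpere : ddbar (mongeAmpere X Ω f) =
    (ricciForm Ω + (1 / 2 : ℝ) • lieDeriv X Ω - Ω) -
      (ricciForm (Ω + ddbar f) + (1 / 2 : ℝ) • lieDeriv X (Ω + ddbar f) - (Ω + ddbar f)) := by
  have h' := hΩ.isNondegenerate_add_ddbar hf hpos
  have hs := isSmooth_log_volumeRatio h' hΩ.isNondegenerate
  have hd := isSmooth_dirDeriv hX hf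
  rw [mongeAmpere, ddbar_add (hs.add (hd.const_smul _)) hf, ddbar_add hs (hd.const_smul _),
    ddbar_const_smul _ hd, ricciForm_eq_sub h' hΩ.isNondegenerate,
    lieDeriv_add_ddbar hX hf hΩ.smooth]
  module

/-- The soliton equation for `Ω + i∂∂̄f` in terms of a Ricci potential `g` of `Ω`. -/
lemma soliton_iff_ddbar_mongeAmpere {g : M → ℝ}
    (hg : ricciForm Ω + (1 / 2 : ℝ) • lieDeriv X Ω - Ω = ddbar g) :
    ricciForm (Ω + ddbar f) + (1 / 2 : ℝ) • lieDeriv X (Ω + ddbar f) = Ω + ddbar f ↔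
      ddbar (mongeAmpere X Ω f) = ddbar (E := E) g := by
  rw [ddbar_mongeAmpere hX hΩ hf hpos, hg]
  exact ⟨fun h => by
    rw [h]
    module,
    fun h => sub_eq_zero.1 (sub_eq_self.1 h)⟩

/-- The volume term is constant along the torus orbits generated by `JX`, and `X·f` inherits
invariance from `f` because `X` is holomorphic. -/
lemma dirDeriv_rotate_mongeAmpere {k : ℕ} [MulAction (Fin k → Circle) M]
    (hT : IsHolomorphicTorusAction E M k) (hJX : InTorusLieAlgebra k (rotate X))
    (hinv : IsTorusInvariant k Ω) (hJ : ∀ p, dirDeriv (rotate X) f p = 0) (p : M) :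
    dirDeriv (rotate X) (mongeAmpere X Ω f) p = 0 := by
  have h' := hΩ.isNondegenerate_add_ddbar hf hpos
  have hs := isSmooth_log_volumeRatio h' hΩ.isNondegenerate
  have hd := isSmooth_dirDeriv hX hf
  rw [mongeAmpere, dirDeriv_add (hs.add (hd.const_smul _)) hf, dirDeriv_add hs (hd.const_smul _),
    dirDeriv_const_smul _ hd]
  simp only [Pi.add_apply, Pi.smul_apply, hJ, dirDeriv_rotate_dirDeriv hX hf hJ p,
    dirDeriv_log_volumeRatio hT hJX hinv hΩ.isNondegenerate hf hJ h' p, smul_zero, add_zero]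

end Soliton

end KRSoliton

/-! ### The equivalence. -/

open KRSoliton in
theorem proposition4p1
    -- the complex manifold `M` with its torus action and the vector field `X`
    {E : Type*} [NormedAddCommGroup E] [NormedSpace ℂ E] [FiniteDimensional ℂ E]
    {M : Type*} [TopologicalSpace M] [T2Space M] [SecondCountableTopology M] [ConnectedSpace M]
    [ChartedSpace E M] [IsManifold 𝓘(ℂ, E) ω M]
    (k : ℕ) [MulAction (Fin k → Circle) M] (hT : IsHolomorphicTorusAction E M k)
    (X : VectorField E M) (hX : IsRealHolomorphic X) (hJX : InTorusLieAlgebra k (rotate X))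
    -- the compact Kähler-Einstein Fano manifold `D`
    {F : Type*} [NormedAddCommGroup F] [NormedSpace ℂ F] [FiniteDimensional ℂ F]
    {D : Type*} [TopologicalSpace D] [T2Space D] [SecondCountableTopology D] [ConnectedSpace D]
    [CompactSpace D] [ChartedSpace F D] [IsManifold 𝓘(ℂ, F) ω D]
    (ΩD : TwoForm F D) (hD : IsKahlerForm ΩD) (hDE : ricciForm ΩD = ΩD)
    -- the background metric
    (Ω : TwoForm E M) (lam : ℝ) (K : Set M) (Khat : Set (ℂ × D))
    (ν : OpenPartialHomeomorph M (ℂ × D))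
    (hΩ : IsBackgroundMetric k X Ω ΩD lam K Khat ν) :
    (∃ φ' : M → ℝ, IsSmooth E φ' ∧ (∀ p, dirDeriv (rotate X) φ' p = 0) ∧
        IsPositive (Ω + ddbar φ') ∧
        ricciForm (Ω + ddbar φ') + (1 / 2 : ℝ) • lieDeriv X (Ω + ddbar φ') = Ω + ddbar φ') ↔
      ∀ a : ℝ, ∃ φ F₂ : M → ℝ,
        IsSmooth E φ ∧ (∀ p, dirDeriv (rotate X) φ p = 0) ∧ IsPositive (Ω + ddbar φ) ∧
        IsSmooth E F₂ ∧ HasCompactSupport F₂ ∧ (∀ p, dirDeriv (rotate X) F₂ p = 0) ∧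
        ricciForm Ω + (1 / 2 : ℝ) • lieDeriv X Ω - Ω = ddbar F₂ ∧
        ∀ p, Real.log (volumeRatio (Ω + ddbar φ) Ω p) - (1 / 2) * dirDeriv X φ p + φ p
          = F₂ p + a := by
  have hK := hΩ.kahler
  constructor
  · rintro ⟨φ', hφ, hJφ, hpos, hsol⟩ a
    obtain ⟨F₁, hF, hFc, hJF, hric⟩ := hΩ.ricci_potential
    have hma := isSmooth_mongeAmpere hX hK hφ hpos
    have hdd := (soliton_iff_ddbar_mongeAmpere hX hK hφ hpos hric).1 hsol
    have hJma := dirDeriv_rotate_mongeAmpere hX hK hφ hpos hT hJX hΩ.torusInvariant hJφ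
    -- the pluriharmonic defect of the Monge-Ampère equation
    let G : M → ℝ := mongeAmpere X Ω φ' + (-1 : ℝ) • F₁
    have hG : IsSmooth E G := hma.add (hF.const_smul _)
    have hGdd : ddbar (E := E) G = 0 := by
      rw [ddbar_add hma (hF.const_smul _), ddbar_const_smul _ hF, hdd]
      module
    have hGJ : ∀ p, dirDeriv (rotate X) G p = 0 := by
      intro p
      rw [dirDeriv_add hma (hF.const_smul _), dirDeriv_const_smul _ hF]
      simp only [Pi.add_apply, Pi.smul_apply, hJma, hJF, smul_zero, add_zero]
    obtain ⟨c, hc⟩ := exists_dirDeriv_eq_const hX hG hGJ hGdd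
    have hconst : IsSmooth E (fun _ : M => a - c / 2) := isSmooth_const _
    -- Subtracting `G` changes the Monge-Ampère expression by `-G + ½ X·G = -G + c/2`, leaving `F₁ +
    -- c/2`; the constant `a - c/2` corrects this to `F₁ + a`. The same `F₁` serves for every `a`.
    let φ : M → ℝ := φ' + ((-1 : ℝ) • G + fun _ => a - c / 2)
    have hφs : IsSmooth E φ := hφ.add ((hG.const_smul _).add hconst)
    have hφdd : ddbar (E := E) φ = ddbar φ' := by
      rw [ddbar_add hφ ((hG.const_smul _).add hconst), ddbar_add (hG.const_smul _) hconst,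
        ddbar_const_smul _ hG, hGdd, ddbar_const]
      module
    have hdir : ∀ Y : VectorField E M, dirDeriv Y φ = dirDeriv Y φ' + (-1 : ℝ) • dirDeriv Y G := by
      intro Y
      rw [dirDeriv_add hφ ((hG.const_smul _).add hconst), dirDeriv_add (hG.const_smul _) hconst,
        dirDeriv_const_smul _ hG, dirDeriv_const, add_zero]
    refine ⟨φ, F₁, hφs, fun p => ?_, by rwa [hφdd], hF, hFc, hJF, hric, fun p => ?_⟩
    · simp only [hdir, Pi.add_apply, Pi.smul_apply, hJφ, hGJ, smul_zero, add_zero]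
    · rw [hφdd, hdir, Pi.add_apply, Pi.smul_apply, hc]
      simp only [φ, G, Pi.add_apply, Pi.smul_apply, smul_eq_mul, mongeAmpere]
      ring
  · intro h
    -- Any `a` would do, since `i∂∂̄` kills constants; with `a = 0` the two functions agree
    -- outright.
    obtain ⟨φ, F₂, hφ, hJφ, hpos, -, -, -, hric, hMA⟩ := h 0
    refine ⟨φ, hφ, hJφ, hpos, (soliton_iff_ddbar_mongeAmpere hX hK hφ hpos hric).2 ?_⟩
    congr 1
    ext1 p
    have := hMA p
    simp only [mongeAmpere, Pi.add_apply, Pi.smul_apply, smul_eq_mul]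
    linarith
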